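/- Let $\mathcal P=P_1(\mathbb R)\times P_1(\mathbb R)$, with affine coordinates $(x,y)$, $x=\cot(\rho/2)$, $y=\cot(\sigma/2)$, and with the $SO(2)\times SO(2)$-invariant measure $d\lambda=d\rho\,d\sigma$. For $g=\begin{pmatrix}a&b\\c&d\end{pmatrix}\in SL(2,\mathbb R)$ put $xg=\frac{xa+c}{xb+d}$, $k_g(x)=\bigl(\frac{(xb+d)^2+(xa+c)^2}{1+x^2}\bigr)^{1/2}$, $s_g(x)=\frac{xb+d}{|xb+d|}$, and for $(g,h)\in\mathcal G=SL(2,\mathbb R)\times SL(2,\mathbb R)$ let $$(T'(g,h)\phi)(x,y)=k_g^{-3}(x)\,s_g(x)\,k_h^{-3}(y)\,s_h(y)\,\phi(xg,yh),\qquad \phi\in L^2(\mathcal P,\lambda,\mathbb R).$$ The little group of $\phi$ is $L_\phi=\{(g,h)\in\mathcal G: T'(g,h)\phi=\phi\}$. Let $R(\theta)=\begin{pmatrix}\cos\theta&\sin\theta\\-\sin\theta&\cos\theta\end{pmatrix}$ and $C_n=\{R(2\pi i/n): 0\le i<n\}$. **Theorem.** Let $\mathcal C$ be a finite little group with two generators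 (that is, generated by two elements but not by one). Then $\mathcal C$ is the (internal) direct product of two cyclic subgroups, and not in a unique way. Moreover $\mathcal C$ is conjugate in $\mathcal G$ to a subgroup of $SO(2)\times SO(2)$. If $\mathcal C$ itself (or else any conjugate of it, which is then to be read for $\mathcal C$ below) lies in $SO(2)\times SO(2)$, then $\mathcal C\subseteq C_n\times C_m$ for some positive even $n,m$, and for all such $n,m$ a possible choice of the two factors is as follows. Let $n=\prod_p p^{a_p}$, $m=\prod_p p^{b_p}$, where $p$ runs over the primes that divide $nm$. These primes can be distributed over nine disjoint sets $N,X,T,\Psi,\Sigma,\Theta,\Phi,\Xi,O$, and there are integers $k_p$, $l_p$, $c_p\ge 0$ with * $p\in N$: $1\le k_p\le\min(a_p,b_p)$, $c_p<p^{k_p}$; * $p\in X$: $1\le k_p\le\min(a_p,b_p)$, $c_p<p^{k_p-1}$; * $p\in T$: $a_p<k_p\le b_p$, $c_p<p^{a_p}$; * $p\in\Psi$: $b_p<k_p\le a_p$, $c_p<p^{b_p}$; * $p\in\Sigma$: $1\le l_p\le k_p\le\min(a_p,b_p)$, $c_p<p^{k_p-l_p}$; * $p\in\Theta$: $1\le l_p<k_p\le\min(a_p,b_p)$,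 $c_p<p^{k_p-l_p-1}$; * $p\in\Phi$: $1\le l_p\le a_p<k_p\le b_p$, $c_p<p^{a_p-l_p}$; * $p\in\Xi$: $1\le l_p\le b_p<k_p\le a_p$, $c_p<p^{b_p-l_p}$; * $2\in N$ with $c_2$ odd, and $\Sigma\cup\Theta\cup\Phi\cup\Xi\ne\varnothing$, such that, with $$\mathcal A_1=\sum_{p\in N\cup\Sigma}c_p\,p^{a_p-k_p}\frac n{p^{a_p}}+\sum_{p\in X\cup\Psi\cup\Theta\cup\Xi}p^{a_p-k_p}\frac n{p^{a_p}}+\sum_{p\in T\cup\Phi}c_p\frac n{p^{a_p}},$$ $$\mathcal B_1=\sum_{p\in N\cup T\cup\Sigma\cup\Phi}p^{b_p-k_p}\frac m{p^{b_p}}+\sum_{p\in X\cup\Theta}c_p\,p^{b_p-k_p+1}\frac m{p^{b_p}}+\sum_{p\in\Psi\cup\Xi}c_p\frac m{p^{b_p}},$$ $$\mathcal A_2=\sum_{p\in\Sigma\cup\Phi}p^{a_p-l_p}\frac n{p^{a_p}},\qquad \mathcal B_2=\sum_{p\in\Theta\cup\Xi}p^{b_p-l_p}\frac m{p^{b_p}},$$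 the group $\mathcal C$ is the direct product $\mathcal C_1\times\mathcal C_2$ of the cyclic groups $$\mathcal C_k=\Bigl\{\Bigl(R\bigl(\tfrac{2\pi}n\mathcal A_k\, i_k\bigr),R\bigl(\tfrac{2\pi}m\mathcal B_k\, i_k\bigr)\Bigr): i_k=0,1,\dots,|\mathcal C_k|-1\Bigr\},\qquad k=1,2,$$ where each element of $\mathcal C_k$ is listed exactly once and $$|\mathcal C_1|=\prod_{p\notin O}p^{k_p},\qquad |\mathcal C_2|=\prod_{p\in\Sigma\cup\Theta\cup\Phi\cup\Xi}p^{l_p}.$$ -/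

import Mathlib

namespace HB

open MeasureTheory Set Filter OnePoint

noncomputable section

/-! ### The group `G × G`, `G = SL(2, ℝ)`, and its subgroup `SO(2) × SO(2)` -/

/-- `G = SL(2, ℝ)`. -/
abbrev G : Type := Matrix.SpecialLinearGroup (Fin 2) ℝ

/-- The group `G × G`. -/
abbrev GG : Type := G × G

/-- The rotation `R(θ)`, with rows `(cos θ, sin θ)` and `(-sin θ, cos θ)`. -/
def R (θ : ℝ) : G :=
  ⟨!![Real.cos θ, Real.sin θ; -Real.sin θ, Real.cos θ], by
    rw [Matrix.det_fin_two_of]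
    nlinarith [Real.sin_sq_add_cos_sq θ]⟩

/-- `SO(2)`, as a subgroup of `SL(2, ℝ)`. -/
def SO2 : Subgroup G where
  carrier := {g | (g : Matrix (Fin 2) (Fin 2) ℝ) ∈ Matrix.specialOrthogonalGroup (Fin 2) ℝ}
  mul_mem' := by
    intro a b ha hb
    simpa using mul_mem ha hb
  one_mem' := by simp
  inv_mem' := by
    intro a ha
    simp only [mem_ofPred_eq, Matrix.mem_specialOrthogonalGroup_iff] at ha ⊢
    refine ⟨?_, a⁻¹.2⟩
    have h1 : (a : Matrix (Fin 2) (Fin 2) ℝ) * star (a : Matrix (Fin 2) (Fin 2) ℝ) = 1 :=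
      (Matrix.mem_orthogonalGroup_iff (Fin 2) ℝ).1 ha.1
    have h2 : ((a⁻¹ : G) : Matrix (Fin 2) (Fin 2) ℝ) * (a : Matrix (Fin 2) (Fin 2) ℝ) = 1 := by
      rw [← Matrix.SpecialLinearGroup.coe_mul, inv_mul_cancel, Matrix.SpecialLinearGroup.coe_one]
    have h3 : ((a⁻¹ : G) : Matrix (Fin 2) (Fin 2) ℝ) = star (a : Matrix (Fin 2) (Fin 2) ℝ) :=
      left_inv_eq_right_inv h2 h1
    rw [h3]
    exact Unitary.star_mem ha.1

/-- The maximal compact subgroup `K = SO(2) × SO(2)` of `G × G`. -/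
def K : Subgroup GG := SO2.prod SO2

/-- `C_n = {R(2πi/n)}`, the cyclic subgroup of order `n` of `SO(2)` (for `n > 0`). -/
def Cyc (n : ℕ) : Subgroup G := Subgroup.zpowers (R (2 * Real.pi / n))

/-! ### The torus `P₁(ℝ) × P₁(ℝ)` and the action of `G × G` on it -/

/-- `P₁(ℝ)`, with the ratio `x = x₁ / x₂ ∈ ℝ ∪ {∞}` of the homogeneous coordinates as
coordinate. -/
abbrev P1 : Type := OnePoint ℝ

instance : MeasurableSpace P1 := borel P1
instance : BorelSpace P1 := ⟨rfl⟩

/-- The torus `P₁(ℝ) × P₁(ℝ)`. -/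
abbrev Torus : Type := P1 × P1

/-- `xa + c`, for `g` with rows `(a, b)` and `(c, d)`. -/
def num (g : G) (x : ℝ) : ℝ := x * g.1 0 0 + g.1 1 0

/-- `xb + d`, for `g` with rows `(a, b)` and `(c, d)`. -/
def den (g : G) (x : ℝ) : ℝ := x * g.1 0 1 + g.1 1 1

open Classical in
/-- The right action `xg = (xa + c) / (xb + d)` of `G` on `P₁(ℝ)`; in particular `∞g = a / b`. -/
def act (g : G) (x : P1) : P1 :=
  x.elim (if g.1 0 1 = 0 then ∞ else ((g.1 0 0 / g.1 0 1 : ℝ) : P1))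
    (fun t : ℝ => if den g t = 0 then ∞ else ((num g t / den g t : ℝ) : P1))

/-- `k_g(x) = {((xb + d)² + (xa + c)²) / (1 + x²)}^{1/2}`, extended continuously to `x = ∞`. -/
def kfac (g : G) (x : P1) : ℝ :=
  x.elim (Real.sqrt (g.1 0 1 ^ 2 + g.1 0 0 ^ 2))
    (fun t : ℝ => Real.sqrt ((den g t ^ 2 + num g t ^ 2) / (1 + t ^ 2)))

/-- `s_g(x) = (xb + d) / |xb + d|`; the values at `x = ∞` and where `xb + d = 0` are
immaterial, these points form a null set. -/
def sfac (g : G) (x : P1) : ℝ :=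
  x.elim (g.1 0 1 / |g.1 0 1|) (fun t : ℝ => den g t / |den g t|)

/-- The rotation invariant measure `dρ = 2 dx / (1 + x²)` on `P₁(ℝ)`, where `x = cot (ρ / 2)`;
the point `∞` has measure zero. -/
def rotMeasure : Measure P1 :=
  (volume.withDensity fun t : ℝ => ENNReal.ofReal (2 / (1 + t ^ 2))).map ((↑) : ℝ → P1)

instance : SFinite rotMeasure := by unfold rotMeasure; infer_instance

/-- The `SO(2) × SO(2)`-invariant measure `λ = dρ dσ` on the torus. -/
def lam : Measure Torus := rotMeasure.prod rotMeasure

/-- The action `(x, y) ↦ (xg, yh)` of `G × G` on the torus. -/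
def torusAct (g : GG) : Torus → Torus := Prod.map (act g.1) (act g.2)

/-- The multiplier `k_g(x)⁻³ s_g(x) k_h(y)⁻³ s_h(y)`. -/
def mult (g : GG) (z : Torus) : ℝ :=
  kfac g.1 z.1 ^ (-3 : ℤ) * sfac g.1 z.1 * kfac g.2 z.2 ^ (-3 : ℤ) * sfac g.2 z.2

/-! Facts needed to see that the action on classes of functions is well defined. -/

lemma measurableEmbedding_coe : MeasurableEmbedding ((↑) : ℝ → P1) :=
  OnePoint.isOpenEmbedding_coe.measurableEmbedding

lemma measurable_of_coe {Y : Type*} [MeasurableSpace Y] {f : P1 → Y}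
    (hf : Measurable fun t : ℝ => f t) : Measurable f := by
  intro S hS
  have : f ⁻¹' S = ((↑) : ℝ → P1) '' ((fun t : ℝ => f t) ⁻¹' S) ∪ ({∞} ∩ f ⁻¹' S) := by
    ext x
    induction x using OnePoint.rec <;> simp
  rw [this]
  refine (measurableEmbedding_coe.measurableSet_image.2 (hf hS)).union ?_
  by_cases h : f ∞ ∈ S
  · have : ({∞} ∩ f ⁻¹' S : Set P1) = {∞} := by ext x; simp; rintro rfl; exact h
    rw [this]; exact measurableSet_singleton _
  · have : ({∞} ∩ f ⁻¹' S : Set P1) = ∅ := by ext x; simp; rintro rfl; exact h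
    rw [this]; exact MeasurableSet.empty

lemma ae_rotMeasure_iff {p : P1 → Prop} :
    (∀ᵐ x ∂rotMeasure, p x) ↔ ∀ᵐ t : ℝ, p t := by
  unfold rotMeasure
  rw [measurableEmbedding_coe.ae_map_iff]
  have hm : Measurable fun t : ℝ => ENNReal.ofReal (2 / (1 + t ^ 2)) := by fun_prop
  rw [ae_withDensity_iff hm]
  refine eventually_congr (Eventually.of_forall fun t => ?_)
  have : ENNReal.ofReal (2 / (1 + t ^ 2)) ≠ 0 := by
    rw [Ne, ENNReal.ofReal_eq_zero, not_le]; positivity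
  simp [this]

lemma det_eq (g : G) : g.1 0 0 * g.1 1 1 - g.1 0 1 * g.1 1 0 = 1 := by
  have := g.2
  rwa [Matrix.det_fin_two] at this

lemma act_coe {g : G} {t : ℝ} (h : den g t ≠ 0) :
    act g t = ((num g t / den g t : ℝ) : P1) := by
  simp [act, h]

lemma ae_den_ne (g : G) : ∀ᵐ t : ℝ, den g t ≠ 0 := by
  rw [ae_iff]
  simp only [not_not]
  refine Set.Subsingleton.measure_zero ?_ _
  intro x hx y hy
  simp only [den, mem_ofPred_eq] at hx hy
  have h := det_eq g
  by_cases hb : g.1 0 1 = 0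
  · rw [hb] at hx h
    have : g.1 1 1 = 0 := by linarith
    rw [this] at h
    norm_num at h
  · exact mul_right_cancel₀ hb (by linarith)

lemma num_div (g h : G) {t : ℝ} (ht : den g t ≠ 0) :
    num h (num g t / den g t) = num (g * h) t / den g t := by
  simp only [num, Matrix.SpecialLinearGroup.coe_mul, Matrix.mul_apply, Fin.sum_univ_two]
  field_simp
  simp only [den]
  ring

lemma den_div (g h : G) {t : ℝ} (ht : den g t ≠ 0) :
    den h (num g t / den g t) = den (g * h) t / den g t := by
  have : den h (num g t / den g t) = (num g t * h.1 0 1 + den g t * h.1 1 1) / den g t := by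
    simp only [den] at ht ⊢
    field_simp
  rw [this]
  congr 1
  simp only [num, den, Matrix.SpecialLinearGroup.coe_mul, Matrix.mul_apply, Fin.sum_univ_two]
  ring

lemma num_one (t : ℝ) : num 1 t = t := by simp [num]
lemma den_one (t : ℝ) : den 1 t = 1 := by simp [den]

lemma measurable_act (g : G) : Measurable (act g) := by
  classical
  apply measurable_of_coe
  simp only [act, OnePoint.elim_some]
  have h1 : Measurable (den g) := by unfold den; fun_prop
  have h2 : Measurable (num g) := by unfold num; fun_prop
  refine Measurable.ite (h1 (measurableSet_singleton 0)) measurable_const ?_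
  exact measurableEmbedding_coe.measurable.comp (h2.div h1)

lemma measurable_kfac (g : G) : Measurable (kfac g) := by
  apply measurable_of_coe
  simp only [kfac, OnePoint.elim_some, num, den]
  fun_prop

lemma measurable_sfac (g : G) : Measurable (sfac g) := by
  apply measurable_of_coe
  simp only [sfac, OnePoint.elim_some, den]
  have h : Measurable fun t : ℝ => t * g.1 0 1 + g.1 1 1 := by fun_prop
  exact h.div h.abs

lemma quasiMeasurePreserving_act (g : G) :
    Measure.QuasiMeasurePreserving (act g) rotMeasure rotMeasure := by
  refine ⟨measurable_act g, ?_⟩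
  refine Measure.AbsolutelyContinuous.mk fun N hN h0 => ?_
  rw [Measure.map_apply (measurable_act g) hN]
  have h0' : ∀ᵐ x ∂rotMeasure, x ∉ N := by rw [ae_iff]; simpa using h0
  suffices h : ∀ᵐ x ∂rotMeasure, act g x ∉ N by
    rw [ae_iff] at h; simpa [Set.preimage] using h
  rw [ae_rotMeasure_iff] at h0' ⊢
  rw [ae_iff] at h0'
  simp only [not_not] at h0'
  set M : Set ℝ := {t : ℝ | (t : P1) ∈ N} with hM
  have key : volume ((fun t => num g⁻¹ t / den g⁻¹ t) '' (M ∩ {t | den g⁻¹ t ≠ 0})) = 0 := by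
    apply addHaar_image_eq_zero_of_differentiableOn_of_addHaar_eq_zero
    · intro t ht
      apply DifferentiableAt.differentiableWithinAt
      have := ht.2
      simp only [num, den, mem_ofPred_eq] at this ⊢
      exact DifferentiableAt.div (by fun_prop) (by fun_prop) this
    · exact measure_mono_null inter_subset_left h0'
  have key' : ∀ᵐ t : ℝ, t ∉ (fun t => num g⁻¹ t / den g⁻¹ t) '' (M ∩ {t | den g⁻¹ t ≠ 0}) := by
    rw [ae_iff]; simp only [not_not]; exact key
  filter_upwards [key', ae_den_ne g] with t h1 h2 h3
  apply h1
  rw [act_coe h2] at h3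
  have hd : den g⁻¹ (num g t / den g t) = 1 / den g t := by
    rw [den_div g _ h2, mul_inv_cancel, den_one]
  refine ⟨num g t / den g t, ⟨h3, ?_⟩, ?_⟩
  · simp only [mem_ofPred_eq]
    rw [hd]
    exact one_div_ne_zero h2
  · simp only
    rw [hd, num_div g _ h2, mul_inv_cancel, num_one]
    field_simp

lemma quasiMeasurePreserving_torusAct (g : GG) :
    Measure.QuasiMeasurePreserving (torusAct g) lam lam := by
  refine ⟨(measurable_act g.1).prodMap (measurable_act g.2), ?_⟩
  have := Measure.map_prod_map rotMeasure rotMeasure (measurable_act g.1) (measurable_act g.2)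
  unfold torusAct lam
  rw [← this]
  exact (quasiMeasurePreserving_act g.1).2.prod (quasiMeasurePreserving_act g.2).2

lemma measurable_mult (g : GG) : Measurable (mult g) := by
  unfold mult
  have h1 : Measurable fun z : Torus => kfac g.1 z.1 := (measurable_kfac g.1).comp measurable_fst
  have h2 : Measurable fun z : Torus => sfac g.1 z.1 := (measurable_sfac g.1).comp measurable_fst
  have h3 : Measurable fun z : Torus => kfac g.2 z.2 := (measurable_kfac g.2).comp measurable_snd
  have h4 : Measurable fun z : Torus => sfac g.2 z.2 := (measurable_sfac g.2).comp measurable_snd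
  simp only [zpow_neg]
  exact (((h1.pow_const 3).inv.mul h2).mul (h3.pow_const 3).inv).mul h4

/-! ### The dual action and the little groups -/

/-- The dual action `(T'(g,h)φ)(x,y) = k_g(x)⁻³ s_g(x) k_h(y)⁻³ s_h(y) φ(xg, yh)`, on classes of
functions on the torus modulo equality `λ`-almost everywhere. -/
def dualAct (g : GG) (φ : Torus →ₘ[lam] ℝ) : Torus →ₘ[lam] ℝ :=
  AEEqFun.mk (mult g) (measurable_mult g).aestronglyMeasurable *
    φ.compQuasiMeasurePreserving (torusAct g) (quasiMeasurePreserving_torusAct g)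

lemma coeFn_dualAct (g : GG) (φ : Torus →ₘ[lam] ℝ) :
    dualAct g φ =ᵐ[lam] fun z => mult g z * φ (torusAct g z) := by
  unfold dualAct
  filter_upwards [AEEqFun.coeFn_mul (AEEqFun.mk (mult g) (measurable_mult g).aestronglyMeasurable)
      (φ.compQuasiMeasurePreserving (torusAct g) (quasiMeasurePreserving_torusAct g)),
    AEEqFun.coeFn_mk (mult g) (measurable_mult g).aestronglyMeasurable (μ := lam),
    AEEqFun.coeFn_compQuasiMeasurePreserving φ (quasiMeasurePreserving_torusAct g)] with z h1 h2 h3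
  rw [h1, Pi.mul_apply, h2, h3, Function.comp_apply]

lemma ae_cocycle (g h : G) : ∀ᵐ x ∂rotMeasure, act (g * h) x = act h (act g x) ∧
    kfac (g * h) x = kfac g x * kfac h (act g x) ∧
    sfac (g * h) x = sfac g x * sfac h (act g x) := by
  rw [ae_rotMeasure_iff]
  filter_upwards [ae_den_ne g, ae_den_ne (g * h)] with t h1 h2
  have h3 : den h (num g t / den g t) ≠ 0 := by
    rw [den_div g h h1]; exact div_ne_zero h2 h1
  rw [act_coe h1, act_coe h2, act_coe h3]
  refine ⟨?_, ?_, ?_⟩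
  · rw [num_div g h h1, den_div g h h1, div_div_div_cancel_right₀ h1]
  · simp only [kfac, OnePoint.elim_some]
    rw [num_div g h h1, den_div g h h1, ← Real.sqrt_mul (by positivity)]
    congr 1
    have : den g t ^ 2 + num g t ^ 2 ≠ 0 := by positivity
    field_simp
  · simp only [sfac, OnePoint.elim_some]
    rw [den_div g h h1, abs_div]
    have : |den g t| ≠ 0 := abs_ne_zero.2 h1
    field_simp

lemma dualAct_mul (g h : GG) (φ : Torus →ₘ[lam] ℝ) :
    dualAct (g * h) φ = dualAct g (dualAct h φ) := by
  apply AEEqFun.ext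
  have c1 : ∀ᵐ z ∂lam, act (g.1 * h.1) z.1 = act h.1 (act g.1 z.1) ∧
      kfac (g.1 * h.1) z.1 = kfac g.1 z.1 * kfac h.1 (act g.1 z.1) ∧
      sfac (g.1 * h.1) z.1 = sfac g.1 z.1 * sfac h.1 (act g.1 z.1) :=
    (Measure.quasiMeasurePreserving_fst (μ := rotMeasure) (ν := rotMeasure)).ae
      (ae_cocycle g.1 h.1)
  have c2 : ∀ᵐ z ∂lam, act (g.2 * h.2) z.2 = act h.2 (act g.2 z.2) ∧
      kfac (g.2 * h.2) z.2 = kfac g.2 z.2 * kfac h.2 (act g.2 z.2) ∧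
      sfac (g.2 * h.2) z.2 = sfac g.2 z.2 * sfac h.2 (act g.2 z.2) :=
    (Measure.quasiMeasurePreserving_snd (μ := rotMeasure) (ν := rotMeasure)).ae
      (ae_cocycle g.2 h.2)
  filter_upwards [c1, c2, coeFn_dualAct (g * h) φ, coeFn_dualAct g (dualAct h φ),
    (quasiMeasurePreserving_torusAct g).ae (coeFn_dualAct h φ)] with z h1 h2 h3 h4 h5
  rw [h3, h4, h5]
  have e1 : torusAct (g * h) z = torusAct h (torusAct g z) := by
    simp only [torusAct, Prod.map, Prod.fst_mul, Prod.snd_mul, h1.1, h2.1]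
  have e2 : mult (g * h) z = mult g z * mult h (torusAct g z) := by
    simp only [mult, torusAct, Prod.map, Prod.fst_mul, Prod.snd_mul, h1.2.1, h1.2.2, h2.2.1,
      h2.2.2, mul_zpow]
    ring
  rw [e1, e2, mul_assoc]

lemma dualAct_one (φ : Torus →ₘ[lam] ℝ) : dualAct 1 φ = φ := by
  apply AEEqFun.ext
  have c : ∀ᵐ x ∂rotMeasure, act 1 x = x ∧ kfac 1 x = 1 ∧ sfac 1 x = 1 := by
    rw [ae_rotMeasure_iff]
    refine Eventually.of_forall fun t => ?_
    have hd : den 1 t ≠ 0 := by rw [den_one]; exact one_ne_zero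
    refine ⟨?_, ?_, ?_⟩
    · rw [act_coe hd, num_one, den_one, div_one]
    · simp only [kfac, OnePoint.elim_some, num_one, den_one]
      have : (1 ^ 2 + t ^ 2 : ℝ) / (1 + t ^ 2) = 1 := by
        rw [one_pow]; exact div_self (by positivity)
      rw [this, Real.sqrt_one]
    · simp [sfac, den_one]
  have c1 : ∀ᵐ z ∂lam, act 1 z.1 = z.1 ∧ kfac 1 z.1 = 1 ∧ sfac 1 z.1 = 1 :=
    (Measure.quasiMeasurePreserving_fst (μ := rotMeasure) (ν := rotMeasure)).ae c
  have c2 : ∀ᵐ z ∂lam, act 1 z.2 = z.2 ∧ kfac 1 z.2 = 1 ∧ sfac 1 z.2 = 1 :=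
    (Measure.quasiMeasurePreserving_snd (μ := rotMeasure) (ν := rotMeasure)).ae c
  filter_upwards [c1, c2, coeFn_dualAct 1 φ] with z h1 h2 h3
  rw [h3]
  simp [mult, torusAct, Prod.map, h1, h2]

/-- The little group `L_φ = {(g,h) | T'(g,h)φ = φ}` of `φ ∈ L²(P₁(ℝ) × P₁(ℝ), λ, ℝ)`, the
topological dual of this Hilbert space being identified with the space itself. -/
def littleGroup (φ : Lp ℝ 2 lam) : Subgroup GG where
  carrier := {g | dualAct g (φ : Torus →ₘ[lam] ℝ) = φ}
  mul_mem' := by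
    intro a b ha hb
    simp only [mem_ofPred_eq] at ha hb ⊢
    rw [dualAct_mul, hb, ha]
  one_mem' := dualAct_one _
  inv_mem' := by
    intro a ha
    simp only [mem_ofPred_eq] at ha ⊢
    conv_lhs => rw [← ha]
    rw [← dualAct_mul, inv_mul_cancel, dualAct_one]

/-- `C` is one of the little groups. -/
def IsLittleGroup (C : Subgroup GG) : Prop := ∃ φ : Lp ℝ 2 lam, C = littleGroup φ

/-! ### Groups with two generators and direct products -/

/-- `C` is a group with two generators: it is generated by two elements, but not by one. -/
def HasTwoGenerators (C : Subgroup GG) : Prop :=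
  (∃ a b : GG, C = Subgroup.closure {a, b}) ∧ ¬ ∃ a : GG, C = Subgroup.zpowers a

/-- `C = C₁ × C₂` as an internal direct product of two cyclic subgroups. -/
structure IsCyclicProduct (C C₁ C₂ : Subgroup GG) : Prop where
  cyclic₁ : IsCyclic C₁
  cyclic₂ : IsCyclic C₂
  commute : ∀ x ∈ C₁, ∀ y ∈ C₂, x * y = y * x
  inf_eq : C₁ ⊓ C₂ = ⊥
  sup_eq : C₁ ⊔ C₂ = C

/-! ### The explicit choice of the two factors -/

/-- The eight ranges of summation in `𝒜₁, ℬ₁, 𝒜₂, ℬ₂`, which have lengths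
`ν, χ, τ, ψ, σ, θ, φ, ξ`, and the remaining indices `none`, which do not contribute. An index
stands for a prime dividing `n` or `m`. -/
inductive Block
  | nu | chi | tau | psi | sigma | theta | phi | xi | none
  deriving DecidableEq

/-- Parameters of a subgroup of `C_n × C_m`: every prime `p` is assigned to a range of summation,
together with exponents `k_p` and `l_p` and one coefficient `c_p`, which is the number called
`r_p`, `ρ_p`, `j_p` or `t_p`, according to the range of `p`. -/
structure Params where
  block : ℕ → Block
  k : ℕ → ℕ
  l : ℕ → ℕ
  c : ℕ → ℕ

/-- The primes `p₁, …, p_s` in the decompositions `n = ∏ p ^ a_p` and `m = ∏ p ^ b_p`. -/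
def primesOf (n m : ℕ) : Finset ℕ := (n * m).primeFactors

namespace Params

/-- The ranges of the parameters at an index `p`, where `a = a_p` and `b = b_p`. -/
def InRange (P : Params) (p a b : ℕ) : Prop :=
  match P.block p with
  | .nu => 1 ≤ P.k p ∧ P.k p ≤ min a b ∧ P.c p < p ^ P.k p
  | .chi => 1 ≤ P.k p ∧ P.k p ≤ min a b ∧ P.c p < p ^ (P.k p - 1)
  | .tau => a < P.k p ∧ P.k p ≤ b ∧ P.c p < p ^ a
  | .psi => b < P.k p ∧ P.k p ≤ a ∧ P.c p < p ^ b
  | .sigma => 1 ≤ P.l p ∧ P.l p ≤ P.k p ∧ P.k p ≤ min a b ∧ P.c p < p ^ (P.k p - P.l p)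
  | .theta => 1 ≤ P.l p ∧ P.l p < P.k p ∧ P.k p ≤ min a b ∧ P.c p < p ^ (P.k p - P.l p - 1)
  | .phi => 1 ≤ P.l p ∧ P.l p ≤ a ∧ a < P.k p ∧ P.k p ≤ b ∧ P.c p < p ^ (a - P.l p)
  | .xi => 1 ≤ P.l p ∧ P.l p ≤ b ∧ b < P.k p ∧ P.k p ≤ a ∧ P.c p < p ^ (b - P.l p)
  | .none => True

/-- The index `p` lies in one of the ranges `ν, χ, τ, ψ, σ, θ, φ, ξ`. -/
def Occurs (P : Params) (p : ℕ) : Prop := P.block p ≠ .none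

/-- The index `p` lies in one of the ranges `σ, θ, φ, ξ`. -/
def OccursTwice (P : Params) (p : ℕ) : Prop :=
  P.block p = .sigma ∨ P.block p = .theta ∨ P.block p = .phi ∨ P.block p = .xi

instance (P : Params) : DecidablePred P.Occurs := fun p => by unfold Occurs; infer_instance
instance (P : Params) : DecidablePred P.OccursTwice := fun p => by
  unfold OccursTwice; infer_instance

/-- The admissible parameters of the little groups with two generators which lie in `C_n × C_m`:
all parameters are in their ranges, the prime `2` lies in the range `ν` with `r_2` odd, and at
least one prime lies in one of the ranges `σ, θ, φ, ξ`. -/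
structure Admissible (P : Params) (n m : ℕ) : Prop where
  inRange : ∀ p ∈ primesOf n m, P.InRange p (n.factorization p) (m.factorization p)
  two_block : P.block 2 = .nu
  two_odd : Odd (P.c 2)
  two_generators : ∃ p ∈ primesOf n m, P.OccursTwice p

/-- The coefficient of `n / p ^ a_p` in `𝒜₁`, where `a = a_p`. -/
def coeffA₁ (P : Params) (p a : ℕ) : ℕ :=
  match P.block p with
  | .nu => P.c p * p ^ (a - P.k p)
  | .chi => p ^ (a - P.k p)
  | .tau => P.c p
  | .psi => p ^ (a - P.k p)
  | .sigma => P.c p * p ^ (a - P.k p)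
  | .theta => p ^ (a - P.k p)
  | .phi => P.c p
  | .xi => p ^ (a - P.k p)
  | .none => 0

/-- The coefficient of `m / p ^ b_p` in `ℬ₁`, where `b = b_p`. -/
def coeffB₁ (P : Params) (p b : ℕ) : ℕ :=
  match P.block p with
  | .nu => p ^ (b - P.k p)
  | .chi => P.c p * p ^ (b - P.k p + 1)
  | .tau => p ^ (b - P.k p)
  | .psi => P.c p
  | .sigma => p ^ (b - P.k p)
  | .theta => P.c p * p ^ (b - P.k p + 1)
  | .phi => p ^ (b - P.k p)
  | .xi => P.c p
  | .none => 0

/-- The coefficient of `n / p ^ a_p` in `𝒜₂`, where `a = a_p`. -/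
def coeffA₂ (P : Params) (p a : ℕ) : ℕ :=
  match P.block p with
  | .sigma | .phi => p ^ (a - P.l p)
  | _ => 0

/-- The coefficient of `m / p ^ b_p` in `ℬ₂`, where `b = b_p`. -/
def coeffB₂ (P : Params) (p b : ℕ) : ℕ :=
  match P.block p with
  | .theta | .xi => p ^ (b - P.l p)
  | _ => 0

/-- `𝒜₁`. -/
def A₁ (P : Params) (n m : ℕ) : ℕ :=
  ∑ p ∈ primesOf n m, P.coeffA₁ p (n.factorization p) * (n / p ^ n.factorization p)

/-- `ℬ₁`. -/
def B₁ (P : Params) (n m : ℕ) : ℕ :=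
  ∑ p ∈ primesOf n m, P.coeffB₁ p (m.factorization p) * (m / p ^ m.factorization p)

/-- `𝒜₂`. -/
def A₂ (P : Params) (n m : ℕ) : ℕ :=
  ∑ p ∈ primesOf n m, P.coeffA₂ p (n.factorization p) * (n / p ^ n.factorization p)

/-- `ℬ₂`. -/
def B₂ (P : Params) (n m : ℕ) : ℕ :=
  ∑ p ∈ primesOf n m, P.coeffB₂ p (m.factorization p) * (m / p ^ m.factorization p)

/-- The order of the first factor: the product of `p ^ k_p` over the eight ranges. -/
def order₁ (P : Params) (n m : ℕ) : ℕ := ∏ p ∈ primesOf n m with P.Occurs p, p ^ P.k p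

/-- The order of the second factor: the product of `p ^ l_p` over the ranges `σ, θ, φ, ξ`. -/
def order₂ (P : Params) (n m : ℕ) : ℕ := ∏ p ∈ primesOf n m with P.OccursTwice p, p ^ P.l p

/-- The element `(R((2π/n) 𝒜₁ i), R((2π/m) ℬ₁ i))`. -/
def elt₁ (P : Params) (n m i : ℕ) : GG :=
  (R (2 * Real.pi / n * P.A₁ n m * i), R (2 * Real.pi / m * P.B₁ n m * i))

/-- The element `(R((2π/n) 𝒜₂ i), R((2π/m) ℬ₂ i))`. -/
def elt₂ (P : Params) (n m i : ℕ) : GG :=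
  (R (2 * Real.pi / n * P.A₂ n m * i), R (2 * Real.pi / m * P.B₂ n m * i))

end Params

end

end HB

namespace HB

open MeasureTheory Set Filter OnePoint

/-! The analysis enters only through the centre of `G × G`. With `-1 = R π`, the element `(-1, -1)`
fixes every `φ`, while `(-1, 1)` and `(1, -1)` act as the scalar `-1`. If one of the latter fixed
`φ`, then `φ = 0` and its little group would be the whole infinite group. So a finite little group
contains `(-1, -1)` but neither of the other two, and the same holds for its conjugates because
these elements are central. Everything else is about finite subgroups of `G × G`.

Averaging an inner product over each of the two projections conjugates a finite subgroup into `SO(2)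
× SO(2)` (`exists_conj_le_K`), and then elements of finite order are rotations by rational multiples
of `2π`. A subgroup `D` of `C_n × C_m` is the same as a lattice `L` in `ℤ²` containing `nℤ × mℤ`
(`rotLattice`), which is studied one prime at a time.

At `p` the problem is a subgroup of `ℤ/p^a × ℤ/p^b`. Let `p^k₁` and `p^k₂` be the orders of its two
projections. A preimage of a generator of the larger projection has maximal order, and the kernel of
that projection is cyclic, of order `p^l` say; together they form a basis (`exists_isLocalBasis`).
Which projection is larger, whether its order exceeds the other prime power, and whether `l = 0`
decide among the eight ranges (`exists_describes`). At `p = 2` the three facts about the centre say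
that the only involution has both coordinates nontrivial, which leaves only `ν` with `c` odd
(`Params.Describes.two_block_eq`).

The local bases are glued by the Chinese remainder theorem into generators `x`, `y`
(`Params.DescribesAll.dvd_iff`, `Params.DescribesAll.span`). Since `l ≤ k` at each prime, the order
of `y` divides that of `x`, so `⟨xy⟩ × ⟨y⟩` is another decomposition; it differs from the first
because `y ≠ 1` when the group is not cyclic. -/

/-! ### Rotations and elements of finite order in `SO(2)`. -/

lemma R_add (s t : ℝ) : R (s + t) = R s * R t := by
  apply Subtype.ext
  change (R (s + t)).1 = (R s).1 * (R t).1
  ext i j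
  fin_cases i <;> fin_cases j <;>
    simp [R, Matrix.mul_apply, Fin.sum_univ_two, Real.cos_add, Real.sin_add] <;> ring

lemma R_zero : R 0 = 1 := by
  ext i j
  fin_cases i <;> fin_cases j <;> simp [R]

lemma R_eq_one_iff (t : ℝ) : R t = 1 ↔ ∃ k : ℤ, (k : ℝ) * (2 * Real.pi) = t := by
  constructor
  · intro h
    rw [← Real.cos_eq_one_iff]
    have := congrArg (fun g : G => g.1 0 0) h
    simpa [R] using this
  · rintro ⟨k, rfl⟩
    ext i j
    have h1 : Real.cos (k * (2 * Real.pi)) = 1 := Real.cos_int_mul_two_pi k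
    have h2 : Real.sin (k * (2 * Real.pi)) = 0 := by
      have := Real.sin_int_mul_pi (2 * k)
      rw [← this]; congr 1; push_cast; ring
    fin_cases i <;> fin_cases j <;> simp [R, h1, h2]

lemma R_nsmul (t : ℝ) (k : ℕ) : R (k * t) = R t ^ k := by
  induction k with
  | zero => simp [R_zero]
  | succ k ih => rw [pow_succ, ← ih, ← R_add]; congr 1; push_cast; ring

lemma exists_R_of_mem_SO2 {g : G} (hg : g ∈ SO2) : ∃ t, g = R t := by
  have h : (g : Matrix (Fin 2) (Fin 2) ℝ) ∈ Matrix.specialOrthogonalGroup (Fin 2) ℝ := hg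
  have h1 := (Matrix.mem_orthogonalGroup_iff (Fin 2) ℝ).1 (Matrix.mem_specialOrthogonalGroup_iff.1 h).1
  have h2 := (Matrix.mem_orthogonalGroup_iff' (Fin 2) ℝ).1 (Matrix.mem_specialOrthogonalGroup_iff.1 h).1
  have hd := det_eq g
  have e00 := congrFun (congrFun h1 0) 0
  have e01 := congrFun (congrFun h1 0) 1
  have e11 := congrFun (congrFun h1 1) 1
  simp [Matrix.mul_apply, Fin.sum_univ_two] at e00 e01 e11
  set a := g.1 0 0
  set b := g.1 0 1
  set c := g.1 1 0
  set d := g.1 1 1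
  have had : d = a := by
    -- The left side equals the sum of the squared row lengths minus twice the determinant, that is
    -- `1 + 1 - 2`.
    have : (a - d) ^ 2 + (b + c) ^ 2 = 0 := by nlinarith
    nlinarith [sq_nonneg (a - d), sq_nonneg (b + c)]
  have hbc : c = -b := by
    have : (a - d) ^ 2 + (b + c) ^ 2 = 0 := by nlinarith
    nlinarith [sq_nonneg (a - d), sq_nonneg (b + c)]
  have hn : ‖(⟨a, b⟩ : ℂ)‖ = 1 := by
    rw [Complex.norm_def, Complex.normSq_mk, e00, Real.sqrt_one]
  have h0 : (⟨a, b⟩ : ℂ) ≠ 0 := by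
    intro h; rw [h] at hn; simp at hn
  refine ⟨Complex.arg ⟨a, b⟩, ?_⟩
  have hc : Real.cos (Complex.arg ⟨a, b⟩) = a := by rw [Complex.cos_arg h0, hn]; simp
  have hs : Real.sin (Complex.arg ⟨a, b⟩) = b := by rw [Complex.sin_arg, hn]; simp
  ext i j
  fin_cases i <;> fin_cases j <;> simp [R, hc, hs]
  · rfl
  · rfl
  · exact hbc
  · exact had

lemma mem_Cyc_of_pow_eq_one {g : G} (hg : g ∈ SO2) {N : ℕ} (hN : 0 < N) (h : g ^ N = 1) :
    g ∈ Cyc N := by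
  obtain ⟨t, rfl⟩ := exists_R_of_mem_SO2 hg
  rw [← R_nsmul, R_eq_one_iff] at h
  obtain ⟨k, hk⟩ := h
  have hN' : (N : ℝ) ≠ 0 := by positivity
  have ht : t = k * (2 * Real.pi / N) := by field_simp; linarith
  have hone : R (2 * Real.pi / N) ^ N = 1 := by
    rw [← R_nsmul, R_eq_one_iff]; exact ⟨1, by field_simp; simp⟩
  have hpos : 0 < (N : ℤ) := by exact_mod_cast hN
  -- `R_nsmul` handles natural multiples only, so `k` is replaced by its residue modulo `N`; the
  -- rest is a whole number of turns.
  have hmod := Int.emod_add_mul_ediv k N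
  obtain ⟨r, hr⟩ := Int.eq_ofNat_of_zero_le (Int.emod_nonneg k hpos.ne')
  refine Subgroup.mem_zpowers_iff.2 ⟨r, ?_⟩
  rw [zpow_natCast, ← R_nsmul]
  have hk' : (k : ℝ) = r + N * ((k / N : ℤ) : ℝ) := by
    rw [hr] at hmod; exact_mod_cast hmod.symm
  have : t = r * (2 * Real.pi / N) + ((k / N : ℤ) : ℝ) * (2 * Real.pi) := by
    rw [ht, hk']; field_simp
  rw [this, R_add, (R_eq_one_iff _).2 ⟨_, rfl⟩, mul_one]

/-! ### The centre of `G × G` and the little groups. -/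

lemma R_pi_apply : (R Real.pi).1 = -1 := by
  ext i j; fin_cases i <;> fin_cases j <;> simp [R]

lemma R_pi_comm (g : G) : R Real.pi * g = g * R Real.pi := by
  apply Subtype.ext
  rw [Matrix.SpecialLinearGroup.coe_mul, Matrix.SpecialLinearGroup.coe_mul]
  change (R Real.pi).1 * g.1 = g.1 * (R Real.pi).1
  rw [R_pi_apply]; simp

lemma R_pi_facts (t : ℝ) : act (R Real.pi) t = t ∧ kfac (R Real.pi) t = 1 ∧
    sfac (R Real.pi) t = -1 := by
  have hd : den (R Real.pi) t = -1 := by simp [den, R]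
  have hn : num (R Real.pi) t = -t := by simp [num, R]
  refine ⟨?_, ?_, ?_⟩
  · rw [act_coe (by rw [hd]; norm_num), hd, hn]; simp
  · simp only [kfac, OnePoint.elim_some, hn, hd]
    have : (((-1) ^ 2 + (-t) ^ 2 : ℝ)) / (1 + t ^ 2) = 1 := by
      rw [div_eq_one_iff_eq (by positivity)]; ring
    rw [this, Real.sqrt_one]
  · simp [sfac, hd]

lemma one_facts (t : ℝ) : act 1 t = t ∧ kfac 1 t = 1 ∧ sfac 1 t = 1 := by
  have hd : den 1 t ≠ 0 := by rw [den_one]; exact one_ne_zero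
  refine ⟨?_, ?_, ?_⟩
  · rw [act_coe hd, num_one, den_one, div_one]
  · simp only [kfac, OnePoint.elim_some, num_one, den_one]
    have : (1 ^ 2 + t ^ 2 : ℝ) / (1 + t ^ 2) = 1 := by
      rw [one_pow]; exact div_self (by positivity)
    rw [this, Real.sqrt_one]
  · simp [sfac, den_one]

/-- An element that fixes the torus pointwise and whose multipliers are the constants `ε`, `δ`
acts by the scalar `ε * δ`. -/
lemma coeFn_dualAct_of_const {g : GG} {ε δ : ℝ}
    (h1 : ∀ t : ℝ, act g.1 t = t ∧ kfac g.1 t = 1 ∧ sfac g.1 t = ε)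
    (h2 : ∀ t : ℝ, act g.2 t = t ∧ kfac g.2 t = 1 ∧ sfac g.2 t = δ) (φ : Torus →ₘ[lam] ℝ) :
    dualAct g φ =ᵐ[lam] fun z => ε * δ * φ z := by
  have c1 : ∀ᵐ z ∂lam, act g.1 z.1 = z.1 ∧ kfac g.1 z.1 = 1 ∧ sfac g.1 z.1 = ε :=
    (Measure.quasiMeasurePreserving_fst (μ := rotMeasure) (ν := rotMeasure)).ae
      (p := fun x => act g.1 x = x ∧ kfac g.1 x = 1 ∧ sfac g.1 x = ε)
      (ae_rotMeasure_iff.2 (Eventually.of_forall h1))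
  have c2 : ∀ᵐ z ∂lam, act g.2 z.2 = z.2 ∧ kfac g.2 z.2 = 1 ∧ sfac g.2 z.2 = δ :=
    (Measure.quasiMeasurePreserving_snd (μ := rotMeasure) (ν := rotMeasure)).ae
      (p := fun x => act g.2 x = x ∧ kfac g.2 x = 1 ∧ sfac g.2 x = δ)
      (ae_rotMeasure_iff.2 (Eventually.of_forall h2))
  filter_upwards [c1, c2, coeFn_dualAct g φ] with z h1 h2 h3
  rw [h3]
  simp [mult, torusAct, Prod.map, h1, h2]

lemma R_pi_R_pi_mem_littleGroup (φ : Lp ℝ 2 lam) : (R Real.pi, R Real.pi) ∈ littleGroup φ := by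
  change dualAct _ _ = _
  apply AEEqFun.ext
  filter_upwards [coeFn_dualAct_of_const (g := (R Real.pi, R Real.pi)) R_pi_facts R_pi_facts
    (φ : Torus →ₘ[lam] ℝ)] with z hz
  rw [hz]; ring

lemma dualAct_zero (g : GG) : dualAct g (0 : Torus →ₘ[lam] ℝ) = 0 := by
  apply AEEqFun.ext
  filter_upwards [coeFn_dualAct g 0, (AEEqFun.coeFn_zero (α := Torus) (β := ℝ) (μ := lam)),
    (quasiMeasurePreserving_torusAct g).ae (AEEqFun.coeFn_zero (α := Torus) (β := ℝ) (μ := lam))]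
    with z h1 h2 h3
  rw [h1, h2, h3]; simp

lemma infinite_GG : Infinite GG := by
  refine Infinite.of_injective
    (fun k : ℕ => ((⟨!![1, (k : ℝ); 0, 1], by simp⟩ : G), (1 : G))) ?_
  intro i j h
  have := congrArg (fun g : GG => g.1.1 0 1) h
  simpa using this

/-- A function fixed by the scalar `-1` is zero, and the zero function is fixed by the whole group,
which is infinite. -/
lemma not_mem_littleGroup_of_neg {φ : Lp ℝ 2 lam} (hfin : (littleGroup φ : Set GG).Finite) {g : GG}
    (hg : ∀ ψ : Torus →ₘ[lam] ℝ, dualAct g ψ =ᵐ[lam] fun z => -ψ z) : g ∉ littleGroup φ := by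
  intro h
  have h' : dualAct g (φ : Torus →ₘ[lam] ℝ) = φ := h
  have h0 : (φ : Torus →ₘ[lam] ℝ) = 0 := by
    apply AEEqFun.ext
    have := hg φ
    rw [h'] at this
    filter_upwards [this, (AEEqFun.coeFn_zero (α := Torus) (β := ℝ) (μ := lam))] with z h1 h2
    rw [h2, Pi.zero_apply]; linarith
  have htop : (littleGroup φ : Set GG) = Set.univ := by
    ext x
    refine ⟨fun _ => trivial, fun _ => ?_⟩
    change dualAct x (φ : Torus →ₘ[lam] ℝ) = φ
    rw [h0, dualAct_zero]
  rw [htop] at hfin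
  exact (Set.infinite_univ_iff.2 infinite_GG) hfin

lemma R_pi_one_not_mem {φ : Lp ℝ 2 lam} (hfin : (littleGroup φ : Set GG).Finite) :
    (R Real.pi, (1 : G)) ∉ littleGroup φ := by
  refine not_mem_littleGroup_of_neg hfin fun ψ => ?_
  filter_upwards [coeFn_dualAct_of_const (g := (R Real.pi, 1)) R_pi_facts one_facts ψ] with z hz
  rw [hz]; ring

lemma one_R_pi_not_mem {φ : Lp ℝ 2 lam} (hfin : (littleGroup φ : Set GG).Finite) :
    ((1 : G), R Real.pi) ∉ littleGroup φ := by
  refine not_mem_littleGroup_of_neg hfin fun ψ => ?_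
  filter_upwards [coeFn_dualAct_of_const (g := (1, R Real.pi)) one_facts R_pi_facts ψ] with z hz
  rw [hz]; ring

/-! ### Conjugation into the maximal compact subgroup -/

/-- This is the Cholesky factorization, with `d = √(det S)` split off so that the triangular factor
has determinant one and hence lies in `G`. -/
lemma exists_transpose_mul_self_of_posDef {S : Matrix (Fin 2) (Fin 2) ℝ} (hS : S.PosDef) :
    ∃ (q : G) (d : ℝ), d ≠ 0 ∧ S = d • (q.1.transpose * q.1) := by
  have hdet := hS.det_pos
  have hp : 0 < S 0 0 := hS.diag_pos
  have hsym : S 1 0 = S 0 1 := by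
    have := congrFun (congrFun hS.isHermitian 0) 1
    simpa using this
  rw [Matrix.det_fin_two, hsym] at hdet
  set d := Real.sqrt (S 0 0 * S 1 1 - S 0 1 * S 0 1) with hd
  have hd0 : 0 < d := Real.sqrt_pos.2 hdet
  have hdd : d ^ 2 = S 0 0 * S 1 1 - S 0 1 * S 0 1 := Real.sq_sqrt hdet.le
  set u := Real.sqrt (S 0 0 / d)
  have hu0 : 0 < u := Real.sqrt_pos.2 (by positivity)
  have huu : u ^ 2 = S 0 0 / d := Real.sq_sqrt (by positivity)
  have hp' : S 0 0 = d * u ^ 2 := by rw [huu]; field_simp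
  refine ⟨⟨!![u, S 0 1 / (d * u); 0, 1 / u], ?_⟩, d, hd0.ne', ?_⟩
  · rw [Matrix.det_fin_two_of]; field_simp; ring
  · ext i j
    fin_cases i <;> fin_cases j <;>
      simp [Matrix.mul_apply, Fin.sum_univ_two, hsym]
    · rw [hp']; ring
    · field_simp
    · field_simp
    · field_simp
      rw [hp'] at hdd
      have : d * (d + S 0 1 ^ 2 / d - u ^ 2 * S 1 1) = 0 := by field_simp; nlinarith
      have h2 : d ^ 2 * (S 1 1 * u ^ 2) = d * (d ^ 2 + S 0 1 ^ 2) := by nlinarith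
      nlinarith

/-- The sum of `hᵀh` over `H` is an `H`-invariant positive definite form. Writing it as a multiple
of `qᵀq` turns invariance under `k` into orthogonality of `qkq⁻¹`. -/
lemma exists_conj_mem_SO2 (H : Subgroup G) [Finite H] :
    ∃ q : G, ∀ h ∈ H, q * h * q⁻¹ ∈ SO2 := by
  classical
  have := Fintype.ofFinite H
  set S : Matrix (Fin 2) (Fin 2) ℝ := ∑ h : H, (h : G).1.transpose * (h : G).1 with hSdef
  have hS : S.PosDef := by
    refine Matrix.posDef_sum Finset.univ_nonempty fun h _ => ?_
    have := Matrix.PosDef.conjTranspose_mul_self (h : G).1 (by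
      apply Matrix.mulVec_injective_of_isUnit
      rw [Matrix.isUnit_iff_isUnit_det, (h : G).2]; exact isUnit_one)
    simpa using this
  obtain ⟨q, d, hd, hq⟩ := exists_transpose_mul_self_of_posDef hS
  have hinv : ∀ k ∈ H, k.1.transpose * S * k.1 = S := by
    intro k hk
    rw [hSdef, Finset.mul_sum, Finset.sum_mul]
    refine Fintype.sum_equiv (Equiv.mulRight ⟨k, hk⟩) _ _ fun h => ?_
    simp [Matrix.mul_assoc]
  refine ⟨q, fun k hk => ?_⟩
  have h1 := hinv k hk
  rw [hq] at h1
  have h2 : k.1.transpose * (q.1.transpose * q.1) * k.1 = q.1.transpose * q.1 := by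
    simp only [Matrix.mul_smul, Matrix.smul_mul] at h1
    exact smul_right_injective _ hd h1
  change ((q * k * q⁻¹ : G) : Matrix (Fin 2) (Fin 2) ℝ) ∈ Matrix.specialOrthogonalGroup (Fin 2) ℝ
  rw [Matrix.mem_specialOrthogonalGroup_iff]
  refine ⟨(Matrix.mem_orthogonalGroup_iff' (Fin 2) ℝ).2 ?_, (q * k * q⁻¹).2⟩
  have hqi : q.1 * (q⁻¹).1 = 1 := congrArg Subtype.val (mul_inv_cancel q)
  have hqt : (q⁻¹).1.transpose * q.1.transpose = 1 := by
    rw [← Matrix.transpose_mul, hqi, Matrix.transpose_one]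
  calc (q.1 * k.1 * (q⁻¹).1).transpose * (q.1 * k.1 * (q⁻¹).1) = (q⁻¹).1.transpose * (k.1.transpose * (q.1.transpose * q.1) * k.1) * (q⁻¹).1 := by
        simp only [Matrix.transpose_mul, Matrix.mul_assoc]
    _ = ((q⁻¹).1.transpose * q.1.transpose) * (q.1 * (q⁻¹).1) := by
        rw [h2]; simp only [Matrix.mul_assoc]
    _ = 1 := by rw [hqt, hqi, mul_one]

lemma exists_conj_le_K {C : Subgroup GG} (hfin : (C : Set GG).Finite) :
    ∃ g : GG, C.map (MulAut.conj g).toMonoidHom ≤ K := by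
  have : Finite C := hfin
  have f1 : Finite (C.map (MonoidHom.fst G G)) := (hfin.image (MonoidHom.fst G G)).to_subtype
  have f2 : Finite (C.map (MonoidHom.snd G G)) := (hfin.image (MonoidHom.snd G G)).to_subtype
  obtain ⟨q, hq⟩ := exists_conj_mem_SO2 (C.map (MonoidHom.fst G G))
  obtain ⟨r, hr⟩ := exists_conj_mem_SO2 (C.map (MonoidHom.snd G G))
  refine ⟨(q, r), ?_⟩
  rintro _ ⟨x, hx, rfl⟩
  exact ⟨hq _ ⟨x, hx, rfl⟩, hr _ ⟨x, hx, rfl⟩⟩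

lemma exists_le_Cyc_prod {D : Subgroup GG} (hfin : (D : Set GG).Finite) (hK : D ≤ K) :
    ∃ n m : ℕ, 0 < n ∧ 0 < m ∧ Even n ∧ Even m ∧ D ≤ (Cyc n).prod (Cyc m) := by
  have : Finite D := hfin
  have hpos : 0 < 2 * Nat.card D := Nat.mul_pos two_pos Nat.card_pos
  -- The order of `D` already kills every element; the factor two only makes the numbers even.
  refine ⟨2 * Nat.card D, 2 * Nat.card D, hpos, hpos, even_two_mul _, even_two_mul _, ?_⟩
  intro x hx
  have h1 : x ^ Nat.card D = 1 := congrArg Subtype.val (pow_card_eq_one' (x := (⟨x, hx⟩ : D)))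
  have h2 : x ^ (2 * Nat.card D) = 1 := by rw [mul_comm, pow_mul, h1, one_pow]
  exact ⟨mem_Cyc_of_pow_eq_one (hK hx).1 hpos (congrArg Prod.fst h2),
    mem_Cyc_of_pow_eq_one (hK hx).2 hpos (congrArg Prod.snd h2)⟩

/-! ### Lattices in `ℤ²` at a single prime. -/

lemma exists_pow_dvd_iff_mem {H : AddSubgroup ℤ} {p a : ℕ} (hp : p.Prime) (h : (p : ℤ) ^ a ∈ H) :
    ∃ e ≤ a, ∀ x, x ∈ H ↔ (p : ℤ) ^ e ∣ x := by
  obtain ⟨g, rfl⟩ := Int.subgroup_cyclic H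
  have hmem : ∀ x, x ∈ AddSubgroup.closure {g} ↔ g ∣ x := fun x => by
    rw [AddSubgroup.mem_closure_singleton]
    constructor
    · rintro ⟨n, rfl⟩; exact Dvd.intro_left n (by simp)
    · rintro ⟨n, rfl⟩; exact ⟨n, by simp [mul_comm]⟩
  have h1 : g.natAbs ∣ p ^ a := by
    have := Int.natAbs_dvd_natAbs.2 ((hmem _).1 h)
    rwa [Int.natAbs_pow, Int.natAbs_natCast] at this
  obtain ⟨e, he, hg⟩ := (Nat.dvd_prime_pow hp).1 h1
  refine ⟨e, he, fun x => ?_⟩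
  rw [hmem, ← Int.natAbs_dvd, hg]
  push_cast
  rfl

/-- Modulo `(p ^ a ℤ) × (p ^ b ℤ)`, the group `M` is the direct sum of the cyclic groups of
orders `p ^ k` and `p ^ l` generated by `(u₁, v₁)` and `(u₂, v₂)`. -/
structure IsLocalBasis (M : AddSubgroup (ℤ × ℤ)) (p a b k l : ℕ) (u₁ v₁ u₂ v₂ : ℤ) : Prop where
  mem₁ : (u₁, v₁) ∈ M
  mem₂ : (u₂, v₂) ∈ M
  span : ∀ x y, (x, y) ∈ M → ∃ i j : ℤ, (p : ℤ) ^ a ∣ x - (i * u₁ + j * u₂) ∧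
    (p : ℤ) ^ b ∣ y - (i * v₁ + j * v₂)
  indep : ∀ i j : ℤ, ((p : ℤ) ^ a ∣ i * u₁ + j * u₂ ∧ (p : ℤ) ^ b ∣ i * v₁ + j * v₂) ↔
    (p : ℤ) ^ k ∣ i ∧ (p : ℤ) ^ l ∣ j

lemma mem_of_dvd_left {M : AddSubgroup (ℤ × ℤ)} {q x : ℤ} (h : (q, (0 : ℤ)) ∈ M) (hx : q ∣ x) :
    (x, (0 : ℤ)) ∈ M := by
  obtain ⟨t, rfl⟩ := hx
  have := M.zsmul_mem h t
  simpa [mul_comm] using this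

lemma mem_of_dvd_right {M : AddSubgroup (ℤ × ℤ)} {q x : ℤ} (h : ((0 : ℤ), q) ∈ M) (hx : q ∣ x) :
    ((0 : ℤ), x) ∈ M := by
  obtain ⟨t, rfl⟩ := hx
  have := M.zsmul_mem h t
  simpa [mul_comm] using this

lemma mem_of_dvd_sub {M : AddSubgroup (ℤ × ℤ)} {q r x y x' y' : ℤ} (hq : (q, (0 : ℤ)) ∈ M)
    (hr : ((0 : ℤ), r) ∈ M) (h : (x, y) ∈ M) (hx : q ∣ x' - x) (hy : r ∣ y' - y) :
    (x', y') ∈ M := by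
  have := M.add_mem h (M.add_mem (mem_of_dvd_left hq hx) (mem_of_dvd_right hr hy))
  simpa using this

lemma dvd_comb_congr {q i j u u' v v' : ℤ} (hu : q ∣ u' - u) (hv : q ∣ v' - v) (x : ℤ) :
    q ∣ x - (i * u' + j * v') ↔ q ∣ x - (i * u + j * v) := by
  refine dvd_iff_dvd_of_dvd_sub ?_
  have : x - (i * u' + j * v') - (x - (i * u + j * v)) = -(i * (u' - u) + j * (v' - v)) := by ring
  rw [this]
  exact ((hu.mul_left i).add (hv.mul_left j)).neg_right

/-- A local basis matters only modulo `p^a` and `p^b`. This allows generators found abstractly to be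
replaced by the prescribed coefficients. -/
lemma IsLocalBasis.congr {M : AddSubgroup (ℤ × ℤ)} {p a b k l : ℕ} {u₁ v₁ u₂ v₂ u₁' v₁' u₂' v₂' : ℤ}
    (h : IsLocalBasis M p a b k l u₁ v₁ u₂ v₂) (ha : ((p : ℤ) ^ a, (0 : ℤ)) ∈ M)
    (hb : ((0 : ℤ), (p : ℤ) ^ b) ∈ M) (hu₁ : (p : ℤ) ^ a ∣ u₁' - u₁) (hv₁ : (p : ℤ) ^ b ∣ v₁' - v₁)
    (hu₂ : (p : ℤ) ^ a ∣ u₂' - u₂) (hv₂ : (p : ℤ) ^ b ∣ v₂' - v₂) :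
    IsLocalBasis M p a b k l u₁' v₁' u₂' v₂' where
  mem₁ := mem_of_dvd_sub ha hb h.mem₁ hu₁ hv₁
  mem₂ := mem_of_dvd_sub ha hb h.mem₂ hu₂ hv₂
  span x y hxy := by
    obtain ⟨i, j, h1, h2⟩ := h.span x y hxy
    exact ⟨i, j, (dvd_comb_congr hu₁ hu₂ x).2 h1, (dvd_comb_congr hv₁ hv₂ y).2 h2⟩
  indep i j := by
    rw [← h.indep i j]
    have e1 := dvd_comb_congr (i := i) (j := j) hu₁ hu₂ 0
    have e2 := dvd_comb_congr (i := i) (j := j) hv₁ hv₂ 0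
    simp only [zero_sub, dvd_neg] at e1 e2
    rw [e1, e2]

lemma IsLocalBasis.swap {M : AddSubgroup (ℤ × ℤ)} {p a b k l : ℕ} {u₁ v₁ u₂ v₂ : ℤ}
    (h : IsLocalBasis (M.comap (AddEquiv.prodComm (M := ℤ) (N := ℤ)).toAddMonoidHom)
      p a b k l u₁ v₁ u₂ v₂) :
    IsLocalBasis M p b a k l v₁ u₁ v₂ u₂ where
  mem₁ := h.mem₁
  mem₂ := h.mem₂
  span x y hxy := by
    obtain ⟨i, j, h1, h2⟩ := h.span y x hxy
    exact ⟨i, j, h2, h1⟩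
  indep i j := by rw [← h.indep i j, and_comm]

/-- The second projection has order `p^k`, at least as large as the first. The second generator
spans its kernel, and the first is a preimage of `p^(b-k)` with first coordinate reduced modulo the
kernel. The parameter `d` fixes the power of `p` extracted from that coordinate: any `d` with `e ≤ d
≤ k` is allowed, and truncated subtraction makes the power trivial once `d ≥ a`. -/
lemma exists_isLocalBasis {M : AddSubgroup (ℤ × ℤ)} {p a b e k d : ℕ} (hp : p.Prime)
    (ha : ((p : ℤ) ^ a, (0 : ℤ)) ∈ M) (he : e ≤ a)
    (hfst : ∀ x y, (x, y) ∈ M → (p : ℤ) ^ (a - e) ∣ x) (hk : k ≤ b)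
    (hsnd : ∀ y, (∃ x, (x, y) ∈ M) ↔ (p : ℤ) ^ (b - k) ∣ y) (hed : e ≤ d) (hdk : d ≤ k) :
    ∃ l c : ℕ, l ≤ e ∧ c < p ^ ((a - l) - (a - d)) ∧
      IsLocalBasis M p a b k l (c * (p : ℤ) ^ (a - d)) ((p : ℤ) ^ (b - k)) ((p : ℤ) ^ (a - l)) 0 := by
  have hp0 : (p : ℤ) ≠ 0 := by exact_mod_cast hp.ne_zero
  obtain ⟨f, hf, hker⟩ := exists_pow_dvd_iff_mem (H := M.comap (AddMonoidHom.inl ℤ ℤ)) hp ha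
  replace hker : ∀ x, (x, (0 : ℤ)) ∈ M ↔ (p : ℤ) ^ f ∣ x := hker
  obtain ⟨l, hl, rfl⟩ : ∃ l ≤ a, f = a - l := ⟨a - f, Nat.sub_le _ _, by omega⟩
  have hle : l ≤ e := by
    have h1 := hfst _ _ ((hker _).2 dvd_rfl)
    have := (Nat.pow_dvd_pow_iff_le_right hp.one_lt).1 (by exact_mod_cast h1)
    omega
  obtain ⟨x₀, hx₀⟩ := (hsnd _).2 (dvd_refl ((p : ℤ) ^ (b - k)))
  have hpl : (0 : ℤ) < (p : ℤ) ^ (a - l) := by have := hp.pos; positivity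
  -- Reducing the first coordinate modulo the generator of the kernel is what later bounds `c`.
  have hx₁ : (x₀ % (p : ℤ) ^ (a - l), (p : ℤ) ^ (b - k)) ∈ M := by
    have := M.sub_mem hx₀ ((hker ((p : ℤ) ^ (a - l) * (x₀ / (p : ℤ) ^ (a - l)))).2 (Dvd.intro _ rfl))
    have h2 : x₀ % (p : ℤ) ^ (a - l) = x₀ - (p : ℤ) ^ (a - l) * (x₀ / (p : ℤ) ^ (a - l)) := by
      rw [Int.emod_def]
    rw [h2]; simpa using this
  have hnn := Int.emod_nonneg x₀ hpl.ne'
  have hlt := Int.emod_lt_of_pos x₀ hpl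
  generalize x₀ % (p : ℤ) ^ (a - l) = x₁ at hx₁ hnn hlt
  have hdv : (p : ℤ) ^ (a - d) ∣ x₁ := (pow_dvd_pow _ (by omega)).trans (hfst _ _ hx₁)
  have hpd : (0 : ℤ) < (p : ℤ) ^ (a - d) := by have := hp.pos; positivity
  obtain ⟨c, rfl⟩ := hdv
  have hc0 : 0 ≤ c := nonneg_of_mul_nonneg_right hnn hpd
  obtain ⟨c, rfl⟩ := Int.eq_ofNat_of_zero_le hc0
  rw [mul_comm] at hx₁ hlt
  refine ⟨l, c, hle, ?_, hx₁, (hker _).2 dvd_rfl, ?_, ?_⟩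
  · have h1 : (p : ℤ) ^ (a - l) = (p : ℤ) ^ ((a - l) - (a - d)) * (p : ℤ) ^ (a - d) := by
      rw [← pow_add]; congr 1; omega
    rw [h1] at hlt
    exact_mod_cast lt_of_mul_lt_mul_right hlt hpd.le
  · intro x y hxy
    obtain ⟨i, rfl⟩ := (hsnd y).1 ⟨x, hxy⟩
    have h1 := M.sub_mem hxy (M.zsmul_mem hx₁ i)
    have h2 : (x - i * (c * (p : ℤ) ^ (a - d)), (0 : ℤ)) ∈ M := by
      simpa [mul_comm] using h1
    obtain ⟨j, hj⟩ := (hker _).1 h2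
    refine ⟨i, j, ?_, ?_⟩
    · have : x - (i * (c * (p : ℤ) ^ (a - d)) + j * (p : ℤ) ^ (a - l)) = 0 := by linarith
      rw [this]; exact dvd_zero _
    · have : (p : ℤ) ^ (b - k) * i - (i * (p : ℤ) ^ (b - k) + j * 0) = 0 := by ring
      rw [this]; exact dvd_zero _
  · intro i j
    have hb' : (p : ℤ) ^ b ∣ i * (p : ℤ) ^ (b - k) + j * 0 ↔ (p : ℤ) ^ k ∣ i := by
      rw [mul_zero, add_zero]
      have : (p : ℤ) ^ b = (p : ℤ) ^ k * (p : ℤ) ^ (b - k) := by rw [← pow_add]; congr 1; omega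
      rw [this]
      exact mul_dvd_mul_iff_right (pow_ne_zero _ hp0)
    rw [hb']
    have hla : (p : ℤ) ^ a ∣ j * (p : ℤ) ^ (a - l) ↔ (p : ℤ) ^ l ∣ j := by
      have : (p : ℤ) ^ a = (p : ℤ) ^ l * (p : ℤ) ^ (a - l) := by rw [← pow_add]; congr 1; omega
      rw [this]
      exact mul_dvd_mul_iff_right (pow_ne_zero _ hp0)
    -- The first coordinate is a multiple of `p^(a-e)` and `e ≤ k`, so `p^k` kills the first
    -- generator and its order is determined by its second coordinate alone.
    have key : (p : ℤ) ^ k ∣ i → (p : ℤ) ^ a ∣ i * (c * (p : ℤ) ^ (a - d)) := by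
      intro hi
      have h1 := mul_dvd_mul hi (hfst _ _ hx₁)
      refine dvd_trans ?_ h1
      rw [← pow_add]
      exact pow_dvd_pow _ (by omega)
    constructor
    · rintro ⟨h1, h2⟩
      exact ⟨h2, hla.1 ((dvd_add_right (key h2)).1 h1)⟩
    · rintro ⟨h1, h2⟩
      exact ⟨(dvd_add_right (key h1)).2 (hla.2 h2), h1⟩

/-- The parameters of `Q` at `p` describe the group `M`. -/
structure Params.Describes (Q : Params) (M : AddSubgroup (ℤ × ℤ)) (p a b : ℕ) : Prop where
  inRange : Q.InRange p a b
  l_le_k : Q.l p ≤ Q.k p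
  k_eq_zero : ¬ Q.Occurs p → Q.k p = 0
  l_eq_zero : ¬ Q.OccursTwice p → Q.l p = 0
  basis : IsLocalBasis M p a b (Q.k p) (Q.l p) (Q.coeffA₁ p a) (Q.coeffB₁ p b) (Q.coeffA₂ p a)
    (Q.coeffB₂ p b)

/-! ### The range of summation to which a prime belongs. -/

lemma exists_describes {M : AddSubgroup (ℤ × ℤ)} {p a b : ℕ} (hp : p.Prime)
    (ha : ((p : ℤ) ^ a, (0 : ℤ)) ∈ M) (hb : ((0 : ℤ), (p : ℤ) ^ b) ∈ M) :
    ∃ Q : Params, Q.Describes M p a b := by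
  obtain ⟨f₁, hf₁, h₁⟩ := exists_pow_dvd_iff_mem (H := M.map (AddMonoidHom.fst ℤ ℤ)) (a := a) hp
    ⟨_, ha, rfl⟩
  obtain ⟨f₂, hf₂, h₂⟩ := exists_pow_dvd_iff_mem (H := M.map (AddMonoidHom.snd ℤ ℤ)) (a := b) hp
    ⟨_, hb, rfl⟩
  obtain ⟨k₁, hk₁, rfl⟩ : ∃ k ≤ a, f₁ = a - k := ⟨a - f₁, Nat.sub_le _ _, by omega⟩
  obtain ⟨k₂, hk₂, rfl⟩ : ∃ k ≤ b, f₂ = b - k := ⟨b - f₂, Nat.sub_le _ _, by omega⟩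
  have hfst : ∀ x, (∃ y, (x, y) ∈ M) ↔ (p : ℤ) ^ (a - k₁) ∣ x := fun x => by
    rw [← h₁]; simp [AddSubgroup.mem_map]
  have hsnd : ∀ y, (∃ x, (x, y) ∈ M) ↔ (p : ℤ) ^ (b - k₂) ∣ y := fun y => by
    rw [← h₂]; simp [AddSubgroup.mem_map]
  rcases le_or_gt k₁ k₂ with hk | hk
  -- Ties `k₁ = k₂` are settled here, in favour of the second coordinate; `d = k₂` gives the factor
  -- `p^(a-k)` of the ranges `ν` and `σ`.
  · obtain ⟨l, c, hl, hc, hB⟩ := exists_isLocalBasis hp ha hk₁ (fun x y h => (hfst x).1 ⟨y, h⟩) hk₂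
      hsnd hk le_rfl
    rcases Nat.eq_zero_or_pos k₂ with rfl | hk0
    · obtain rfl : k₁ = 0 := by omega
      obtain rfl : l = 0 := by omega
      refine ⟨⟨fun _ => .none, fun _ => 0, fun _ => 0, fun _ => 0⟩, ?_, le_rfl, fun _ => rfl,
        fun _ => rfl, ?_⟩
      · trivial
      · refine hB.congr ha hb ?_ ?_ ?_ ?_ <;>
          simp [Params.coeffA₁, Params.coeffA₂, Params.coeffB₁, Params.coeffB₂]
    rcases Nat.eq_zero_or_pos l with rfl | hl0
    · rcases le_or_gt k₂ a with hka | hka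
      · refine ⟨⟨fun _ => .nu, fun _ => k₂, fun _ => 0, fun _ => c⟩, ?_, Nat.zero_le _, ?_,
          fun _ => rfl, ?_⟩
        · refine ⟨hk0, le_min hka hk₂, ?_⟩
          have : a - 0 - (a - k₂) = k₂ := by omega
          rwa [this] at hc
        · intro h; exact absurd (by simp [Params.Occurs]) h
        · refine hB.congr ha hb ?_ ?_ ?_ ?_ <;>
            simp [Params.coeffA₁, Params.coeffA₂, Params.coeffB₁, Params.coeffB₂]
      · refine ⟨⟨fun _ => .tau, fun _ => k₂, fun _ => 0, fun _ => c⟩, ?_, Nat.zero_le _, ?_,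
          fun _ => rfl, ?_⟩
        · refine ⟨hka, hk₂, ?_⟩
          have : a - 0 - (a - k₂) = a := by omega
          rwa [this] at hc
        · intro h; exact absurd (by simp [Params.Occurs]) h
        -- As `k₂ > a`, truncated subtraction removes the power of `p`, leaving the bare coefficient
        -- `c`.
        · have : a - k₂ = 0 := by omega
          refine hB.congr ha hb ?_ ?_ ?_ ?_ <;>
            simp [Params.coeffA₁, Params.coeffA₂, Params.coeffB₁, Params.coeffB₂, this]
    · rcases le_or_gt k₂ a with hka | hka
      · refine ⟨⟨fun _ => .sigma, fun _ => k₂, fun _ => l, fun _ => c⟩, ?_, hl.trans hk, ?_, ?_, ?_⟩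
        · refine ⟨hl0, hl.trans hk, le_min hka hk₂, ?_⟩
          have : a - l - (a - k₂) = k₂ - l := by omega
          rwa [this] at hc
        · intro h; exact absurd (by simp [Params.Occurs]) h
        · intro h; exact absurd (by simp [Params.OccursTwice]) h
        · refine hB.congr ha hb ?_ ?_ ?_ ?_ <;>
            simp [Params.coeffA₁, Params.coeffA₂, Params.coeffB₁, Params.coeffB₂]
      · refine ⟨⟨fun _ => .phi, fun _ => k₂, fun _ => l, fun _ => c⟩, ?_, hl.trans hk, ?_, ?_, ?_⟩
        · refine ⟨hl0, hl.trans hk₁, hka, hk₂, ?_⟩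
          have : a - l - (a - k₂) = a - l := by omega
          rwa [this] at hc
        · intro h; exact absurd (by simp [Params.Occurs]) h
        · intro h; exact absurd (by simp [Params.OccursTwice]) h
        · have : a - k₂ = 0 := by omega
          refine hB.congr ha hb ?_ ?_ ?_ ?_ <;>
            simp [Params.coeffA₁, Params.coeffA₂, Params.coeffB₁, Params.coeffB₂, this]
  -- Here `k₂ < k₁` strictly, so `d = k₁ - 1` is allowed; it produces the extra factor `p` in the
  -- ranges `χ` and `θ`, and no power at all when `k₁ > b`.
  · obtain ⟨l, c, hl, hc, hB⟩ := exists_isLocalBasis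
      (M := M.comap (AddEquiv.prodComm (M := ℤ) (N := ℤ)).toAddMonoidHom) (d := k₁ - 1) hp hb hk₂
      (fun x y h => (hsnd x).1 ⟨y, h⟩) hk₁ hfst (by omega) (by omega)
    replace hB := hB.swap
    rcases Nat.eq_zero_or_pos l with rfl | hl0
    · rcases le_or_gt k₁ b with hkb | hkb
      · have e : b - (k₁ - 1) = b - k₁ + 1 := by omega
        refine ⟨⟨fun _ => .chi, fun _ => k₁, fun _ => 0, fun _ => c⟩, ?_, Nat.zero_le _, ?_,
          fun _ => rfl, ?_⟩
        · refine ⟨(show 1 ≤ k₁ by omega), le_min hk₁ hkb, ?_⟩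
          have : b - 0 - (b - (k₁ - 1)) = k₁ - 1 := by omega
          rwa [this] at hc
        · intro h; exact absurd (by simp [Params.Occurs]) h
        · refine hB.congr ha hb ?_ ?_ ?_ ?_ <;>
            simp [Params.coeffA₁, Params.coeffA₂, Params.coeffB₁, Params.coeffB₂, e]
      · have e : b - (k₁ - 1) = 0 := by omega
        refine ⟨⟨fun _ => .psi, fun _ => k₁, fun _ => 0, fun _ => c⟩, ?_, Nat.zero_le _, ?_,
          fun _ => rfl, ?_⟩
        · refine ⟨hkb, hk₁, ?_⟩
          have : b - 0 - (b - (k₁ - 1)) = b := by omega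
          rwa [this] at hc
        · intro h; exact absurd (by simp [Params.Occurs]) h
        · refine hB.congr ha hb ?_ ?_ ?_ ?_ <;>
            simp [Params.coeffA₁, Params.coeffA₂, Params.coeffB₁, Params.coeffB₂, e]
    · rcases le_or_gt k₁ b with hkb | hkb
      · have e : b - (k₁ - 1) = b - k₁ + 1 := by omega
        have hlk : l < k₁ := by omega
        refine ⟨⟨fun _ => .theta, fun _ => k₁, fun _ => l, fun _ => c⟩, ?_, hlk.le, ?_, ?_, ?_⟩
        · refine ⟨hl0, hlk, le_min hk₁ hkb, ?_⟩
          have : b - l - (b - (k₁ - 1)) = k₁ - l - 1 := by omega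
          rwa [this] at hc
        · intro h; exact absurd (by simp [Params.Occurs]) h
        · intro h; exact absurd (by simp [Params.OccursTwice]) h
        · refine hB.congr ha hb ?_ ?_ ?_ ?_ <;>
            simp [Params.coeffA₁, Params.coeffA₂, Params.coeffB₁, Params.coeffB₂, e]
      · have e : b - (k₁ - 1) = 0 := by omega
        have hlk : l < k₁ := by omega
        refine ⟨⟨fun _ => .xi, fun _ => k₁, fun _ => l, fun _ => c⟩, ?_, hlk.le, ?_, ?_, ?_⟩
        · refine ⟨hl0, hl.trans hk₂, hkb, hk₁, ?_⟩
          have : b - l - (b - (k₁ - 1)) = b - l := by omega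
          rwa [this] at hc
        · intro h; exact absurd (by simp [Params.Occurs]) h
        · intro h; exact absurd (by simp [Params.OccursTwice]) h
        · refine hB.congr ha hb ?_ ?_ ?_ ?_ <;>
            simp [Params.coeffA₁, Params.coeffA₂, Params.coeffB₁, Params.coeffB₂, e]

/-- In every range except `ν` with `c` odd, a suitable `2`-power multiple of one of the generators
is an involution supported on one coordinate, or else there is no involution at all. The hypotheses
exclude both. -/
lemma Params.Describes.two_block_eq {Q : Params} {M : AddSubgroup (ℤ × ℤ)} {a b : ℕ}
    (h : Q.Describes M 2 a b) (ha0 : 0 < a) (ha : ((2 : ℤ) ^ a, (0 : ℤ)) ∈ M)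
    (hb : ((0 : ℤ), (2 : ℤ) ^ b) ∈ M) (hab : ((2 : ℤ) ^ (a - 1), (2 : ℤ) ^ (b - 1)) ∈ M)
    (hna : ((2 : ℤ) ^ (a - 1), (0 : ℤ)) ∉ M) (hnb : ((0 : ℤ), (2 : ℤ) ^ (b - 1)) ∉ M) :
    Q.block 2 = .nu ∧ Odd (Q.c 2) := by
  have hr := h.inRange
  have h1 := h.basis.mem₁
  have h2 := h.basis.mem₂
  have hsp := h.basis.span _ _ hab
  have left : ∀ {x y : ℤ}, (x, y) ∈ M → ∀ t : ℕ, (2 : ℤ) ^ t * x = 2 ^ (a - 1) →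
      (2 : ℤ) ^ b ∣ 2 ^ t * y → False := by
    intro x y hxy t hx hy
    apply hna
    have := M.zsmul_mem hxy ((2 : ℤ) ^ t)
    refine mem_of_dvd_sub ha hb this ?_ ?_
    · simp [hx]
    · simpa using hy
  have right : ∀ {x y : ℤ}, (x, y) ∈ M → ∀ t : ℕ, (2 : ℤ) ^ a ∣ 2 ^ t * x →
      (2 : ℤ) ^ t * y = 2 ^ (b - 1) → False := by
    intro x y hxy t hx hy
    apply hnb
    have := M.zsmul_mem hxy ((2 : ℤ) ^ t)
    refine mem_of_dvd_sub ha hb this ?_ ?_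
    · simpa using hx
    · simp [hy]
  have pw : ∀ {s t r : ℕ}, s + t = r → (2 : ℤ) ^ s * 2 ^ t = 2 ^ r := by
    rintro s t r rfl; rw [pow_add]
  simp only [Params.InRange, Params.coeffA₁, Params.coeffA₂, Params.coeffB₁, Params.coeffB₂]
    at hr h1 h2 hsp
  cases hblk : Q.block 2 <;> simp only [hblk] at hr h1 h2 hsp <;> push_cast at h1 h2
  · refine ⟨rfl, ?_⟩
    by_contra hodd
    obtain ⟨c, hc⟩ := Nat.not_odd_iff_even.1 hodd
    have hk := hr.2.1
    -- For even `c`, the multiple by `2^(k-1)` already kills the first coordinate, while the second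
    -- becomes `2^(b-1)`.
    refine right h1 (Q.k 2 - 1) ?_ (pw (by omega))
    refine ⟨c, ?_⟩
    rw [hc, ← pw (show Q.k 2 - 1 + 1 + (a - Q.k 2) = a by omega), pow_succ]
    push_cast; ring
  · exfalso
    have hk := hr.2.1
    refine left h1 (Q.k 2 - 1) (pw (by omega)) ⟨Q.c 2, ?_⟩
    rw [← pw (show Q.k 2 - 1 + (b - Q.k 2 + 1) = b by omega)]; ring
  · exfalso
    exact right h1 (Q.k 2 - 1) (dvd_mul_of_dvd_left (pow_dvd_pow _ (by omega)) _) (pw (by omega))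
  · exfalso
    exact left h1 (Q.k 2 - 1) (pw (by omega)) (dvd_mul_of_dvd_left (pow_dvd_pow _ (by omega)) _)
  · exfalso
    exact left h2 (Q.l 2 - 1) (pw (by omega)) (by simp)
  · exfalso
    exact right h2 (Q.l 2 - 1) (by simp) (pw (by omega))
  · exfalso
    exact left h2 (Q.l 2 - 1) (pw (by omega)) (by simp)
  · exfalso
    exact right h2 (Q.l 2 - 1) (by simp) (pw (by omega))
  · exfalso
    -- Both generators are zero here, so the span condition for the diagonal involution would force
    -- `2^a ∣ 2^(a-1)`.
    obtain ⟨i, j, hij, -⟩ := hsp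
    have h3 : (2 : ℕ) ^ a ∣ 2 ^ (a - 1) := by
      have h4 : (2 : ℤ) ^ a ∣ 2 ^ (a - 1) := by simpa using hij
      exact_mod_cast h4
    have := (Nat.pow_dvd_pow_iff_le_right one_lt_two).1 h3
    omega

/-! ### Gluing the primes by the Chinese remainder theorem. -/

lemma prod_pow_dvd_iff {S : Finset ℕ} (hS : ∀ q ∈ S, q.Prime) (e : ℕ → ℕ) (x : ℤ) :
    ((∏ q ∈ S, q ^ e q : ℕ) : ℤ) ∣ x ↔ ∀ q ∈ S, (q : ℤ) ^ e q ∣ x := by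
  push_cast
  refine ⟨fun h q hq => (Finset.dvd_prod_of_mem (fun q : ℕ => (q : ℤ) ^ e q) hq).trans h,
    fun h => Finset.prod_dvd_of_coprime ?_ h⟩
  intro p hp q hq hpq
  exact (Nat.isCoprime_iff_coprime.2 ((Nat.coprime_primes (hS p hp) (hS q hq)).2 hpq)).pow

lemma prod_pow_factorization_eq_of_subset {n : ℕ} (hn : n ≠ 0) {S : Finset ℕ}
    (h : n.primeFactors ⊆ S) : ∏ q ∈ S, q ^ n.factorization q = n := by
  conv_rhs => rw [← Nat.prod_factorization_pow_eq_self hn]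
  exact (Finsupp.prod_of_support_subset _ h _ (by simp)).symm

lemma pow_mul_cofactor (n p : ℕ) :
    (p : ℤ) ^ n.factorization p * ((n / p ^ n.factorization p : ℕ) : ℤ) = n := by
  exact_mod_cast Nat.ordProj_mul_ordCompl_eq_self n p

lemma isCoprime_cofactor {n p : ℕ} (hn : n ≠ 0) (hp : p.Prime) (e : ℕ) :
    IsCoprime ((p : ℤ) ^ e) ((n / p ^ n.factorization p : ℕ) : ℤ) :=
  (Nat.isCoprime_iff_coprime.2 (Nat.coprime_ordCompl hp hn)).pow_left

/-- For `q ≠ p` the cofactor of `q` is divisible by the full `p`-part of `n`, so multiplying by the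
cofactor of `p` completes it to a multiple of `n`. -/
lemma dvd_cofactor_mul_sum_sub {n : ℕ} {S : Finset ℕ} (hS : ∀ q ∈ S, q.Prime) {p : ℕ}
    (hp : p ∈ S) (f : ℕ → ℕ) :
    (n : ℤ) ∣ (n / p ^ n.factorization p : ℕ) *
      (((∑ q ∈ S, f q * (n / q ^ n.factorization q) : ℕ) : ℤ) -
        f p * (n / p ^ n.factorization p : ℕ)) := by
  have e : (((∑ q ∈ S, f q * (n / q ^ n.factorization q) : ℕ) : ℤ) -
        f p * (n / p ^ n.factorization p : ℕ)) =
      ((∑ q ∈ S.erase p, f q * (n / q ^ n.factorization q) : ℕ) : ℤ) := by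
    rw [← Finset.add_sum_erase S _ hp]
    push_cast
    ring
  rw [e]
  norm_cast
  rw [Finset.mul_sum]
  refine Finset.dvd_sum fun q hq => ?_
  have hq' := Finset.mem_erase.1 hq
  have h1 : p ^ n.factorization p ∣ n / q ^ n.factorization q := by
    refine Nat.dvd_div_of_mul_dvd ?_
    refine Nat.Coprime.mul_dvd_of_dvd_of_dvd ?_ (Nat.ordProj_dvd n q) (Nat.ordProj_dvd n p)
    exact Nat.Coprime.pow _ _ ((Nat.coprime_primes (hS q hq'.2) (hS p hp)).2 hq'.1)
  conv_lhs => rw [← Nat.ordProj_mul_ordCompl_eq_self n p]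
  rw [mul_comm]
  exact mul_dvd_mul_left _ (h1.mul_left _)

lemma pow_dvd_sum_sub {n : ℕ} (hn : n ≠ 0) {S : Finset ℕ} (hS : ∀ q ∈ S, q.Prime) {p : ℕ}
    (hp : p ∈ S) (f : ℕ → ℕ) :
    (p : ℤ) ^ n.factorization p ∣ ((∑ q ∈ S, f q * (n / q ^ n.factorization q) : ℕ) : ℤ) -
        f p * (n / p ^ n.factorization p : ℕ) := by
  have h := dvd_cofactor_mul_sum_sub (n := n) hS hp f
  have h1 : (p : ℤ) ^ n.factorization p ∣ n := Dvd.intro _ (pow_mul_cofactor n p)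
  exact (isCoprime_cofactor hn (hS p hp) _).dvd_of_dvd_mul_left (h1.trans h)

/-- Modulo the `p`-part of `n` only the summand of `p` survives, and its cofactor is a unit there.
-/
lemma pow_dvd_comb_sum_iff {n : ℕ} (hn : n ≠ 0) {S : Finset ℕ} (hS : ∀ q ∈ S, q.Prime) {p : ℕ}
    (hp : p ∈ S) (f g : ℕ → ℕ) (i j : ℤ) :
    (p : ℤ) ^ n.factorization p ∣ i * ((∑ q ∈ S, f q * (n / q ^ n.factorization q) : ℕ) : ℤ) +
        j * ((∑ q ∈ S, g q * (n / q ^ n.factorization q) : ℕ) : ℤ) ↔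
      (p : ℤ) ^ n.factorization p ∣ i * f p + j * g p := by
  have e := dvd_comb_congr (i := i) (j := j) (pow_dvd_sum_sub hn hS hp f)
    (pow_dvd_sum_sub hn hS hp g) 0
  simp only [zero_sub, dvd_neg] at e
  rw [e]
  have : i * (f p * ((n / p ^ n.factorization p : ℕ) : ℤ)) +
      j * (g p * ((n / p ^ n.factorization p : ℕ) : ℤ)) =
      ((n / p ^ n.factorization p : ℕ) : ℤ) * (i * f p + j * g p) := by ring
  rw [this]
  exact ⟨(isCoprime_cofactor hn (hS p hp) _).dvd_of_dvd_mul_left, fun h => h.mul_left _⟩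

/-- The pairs `(i, j)` with `(s i, t j) ∈ L`. -/
def scaledComap (L : AddSubgroup (ℤ × ℤ)) (s t : ℤ) : AddSubgroup (ℤ × ℤ) :=
  L.comap ((AddMonoidHom.mulLeft s).prodMap (AddMonoidHom.mulLeft t))

lemma mem_scaledComap {L : AddSubgroup (ℤ × ℤ)} {s t x y : ℤ} :
    (x, y) ∈ scaledComap L s t ↔ (s * x, t * y) ∈ L := Iff.rfl

lemma prime_of_mem_primesOf {n m p : ℕ} (h : p ∈ primesOf n m) : p.Prime :=
  Nat.prime_of_mem_primeFactors h

/-- At each prime `p`, the parameters `P` describe the `p`-part of `L / (n ℤ × m ℤ)`. -/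
def Params.DescribesAll (P : Params) (L : AddSubgroup (ℤ × ℤ)) (n m : ℕ) : Prop :=
  ∀ p ∈ primesOf n m, P.Describes
    (scaledComap L (n / p ^ n.factorization p : ℕ) (m / p ^ m.factorization p : ℕ)) p
    (n.factorization p) (m.factorization p)

lemma left_mem_scaledComap {L : AddSubgroup (ℤ × ℤ)} {n : ℕ} (hn : ((n : ℤ), (0 : ℤ)) ∈ L)
    (t : ℤ) (p : ℕ) : ((p : ℤ) ^ n.factorization p, (0 : ℤ)) ∈
      scaledComap L (n / p ^ n.factorization p : ℕ) t := by
  rw [mem_scaledComap, mul_comm, pow_mul_cofactor, mul_zero]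
  exact hn

lemma right_mem_scaledComap {L : AddSubgroup (ℤ × ℤ)} {m : ℕ} (hm : ((0 : ℤ), (m : ℤ)) ∈ L)
    (s : ℤ) (p : ℕ) : ((0 : ℤ), (p : ℤ) ^ m.factorization p) ∈
      scaledComap L s (m / p ^ m.factorization p : ℕ) := by
  rw [mem_scaledComap, mul_comm _ ((p : ℤ) ^ _), pow_mul_cofactor, mul_zero]
  exact hm

lemma exists_describesAll {L : AddSubgroup (ℤ × ℤ)} {n m : ℕ} (hn : ((n : ℤ), (0 : ℤ)) ∈ L)
    (hm : ((0 : ℤ), (m : ℤ)) ∈ L) : ∃ P : Params, P.DescribesAll L n m := by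
  have h : ∀ p : ℕ, ∃ Q : Params, p ∈ primesOf n m → Q.Describes
      (scaledComap L (n / p ^ n.factorization p : ℕ) (m / p ^ m.factorization p : ℕ)) p
      (n.factorization p) (m.factorization p) := by
    intro p
    by_cases hp : p ∈ primesOf n m
    · obtain ⟨Q, hQ⟩ := exists_describes (prime_of_mem_primesOf hp) (left_mem_scaledComap hn _ p)
        (right_mem_scaledComap hm _ p)
      exact ⟨Q, fun _ => hQ⟩
    · exact ⟨⟨fun _ => .none, fun _ => 0, fun _ => 0, fun _ => 0⟩, fun h => absurd h hp⟩
  choose Q hQ using h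
  refine ⟨⟨fun p => (Q p).block p, fun p => (Q p).k p, fun p => (Q p).l p, fun p => (Q p).c p⟩,
    fun p hp => ?_⟩
  have := hQ p hp
  exact ⟨this.inRange, this.l_le_k, this.k_eq_zero, this.l_eq_zero, this.basis⟩

namespace Params.DescribesAll

variable {P : Params} {L : AddSubgroup (ℤ × ℤ)} {n m : ℕ}

lemma order₁_eq (h : P.DescribesAll L n m) : P.order₁ n m = ∏ p ∈ primesOf n m, p ^ P.k p := by
  rw [Params.order₁, Finset.prod_filter]
  refine Finset.prod_congr rfl fun p hp => ?_
  split_ifs with ho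
  · rfl
  · rw [(h p hp).k_eq_zero ho, pow_zero]

lemma order₂_eq (h : P.DescribesAll L n m) : P.order₂ n m = ∏ p ∈ primesOf n m, p ^ P.l p := by
  rw [Params.order₂, Finset.prod_filter]
  refine Finset.prod_congr rfl fun p hp => ?_
  split_ifs with ho
  · rfl
  · rw [(h p hp).l_eq_zero ho, pow_zero]

lemma order₂_dvd_order₁ (h : P.DescribesAll L n m) : P.order₂ n m ∣ P.order₁ n m := by
  rw [h.order₁_eq, h.order₂_eq]
  exact Finset.prod_dvd_prod_of_dvd _ _ fun p hp => pow_dvd_pow p (h p hp).l_le_k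

lemma order₁_pos (h : P.DescribesAll L n m) : 0 < P.order₁ n m := by
  rw [h.order₁_eq]
  exact Finset.prod_pos fun p hp => pow_pos (prime_of_mem_primesOf hp).pos _

lemma order₂_pos (h : P.DescribesAll L n m) : 0 < P.order₂ n m := by
  rw [h.order₂_eq]
  exact Finset.prod_pos fun p hp => pow_pos (prime_of_mem_primesOf hp).pos _

lemma dvd_iff (hn : n ≠ 0) (hm : m ≠ 0) (h : P.DescribesAll L n m) (i j : ℤ) :
    ((n : ℤ) ∣ i * P.A₁ n m + j * P.A₂ n m ∧ (m : ℤ) ∣ i * P.B₁ n m + j * P.B₂ n m) ↔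
      (P.order₁ n m : ℤ) ∣ i ∧ (P.order₂ n m : ℤ) ∣ j := by
  have hS : ∀ q ∈ primesOf n m, q.Prime := fun q hq => prime_of_mem_primesOf hq
  have hnS : n.primeFactors ⊆ primesOf n m :=
    Nat.primeFactors_mono (Dvd.intro _ rfl) (mul_ne_zero hn hm)
  have hmS : m.primeFactors ⊆ primesOf n m :=
    Nat.primeFactors_mono (Dvd.intro_left _ rfl) (mul_ne_zero hn hm)
  have en : ∀ x : ℤ, (n : ℤ) ∣ x ↔ ∀ q ∈ primesOf n m, (q : ℤ) ^ n.factorization q ∣ x := fun x => by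
    rw [← prod_pow_dvd_iff hS, prod_pow_factorization_eq_of_subset hn hnS]
  have em : ∀ x : ℤ, (m : ℤ) ∣ x ↔ ∀ q ∈ primesOf n m, (q : ℤ) ^ m.factorization q ∣ x := fun x => by
    rw [← prod_pow_dvd_iff hS, prod_pow_factorization_eq_of_subset hm hmS]
  rw [en, em, h.order₁_eq, h.order₂_eq, prod_pow_dvd_iff hS, prod_pow_dvd_iff hS]
  rw [← forall₂_and, ← forall₂_and]
  refine forall₂_congr fun p hp => ?_
  rw [← (h p hp).basis.indep i j]
  exact and_congr (pow_dvd_comb_sum_iff hn hS hp (fun q => P.coeffA₁ q (n.factorization q))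
      (fun q => P.coeffA₂ q (n.factorization q)) i j)
    (pow_dvd_comb_sum_iff hm hS hp (fun q => P.coeffB₁ q (m.factorization q))
      (fun q => P.coeffB₂ q (m.factorization q)) i j)

lemma mem₁ (h : P.DescribesAll L n m) : ((P.A₁ n m : ℤ), (P.B₁ n m : ℤ)) ∈ L := by
  have : ((P.A₁ n m : ℤ), (P.B₁ n m : ℤ)) = ∑ p ∈ primesOf n m,
      (((n / p ^ n.factorization p : ℕ) : ℤ) * P.coeffA₁ p (n.factorization p),
        ((m / p ^ m.factorization p : ℕ) : ℤ) * P.coeffB₁ p (m.factorization p)) := by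
    apply Prod.ext
    · simp only [Prod.fst_sum, Params.A₁]; push_cast; exact Finset.sum_congr rfl fun _ _ => mul_comm _ _
    · simp only [Prod.snd_sum, Params.B₁]; push_cast; exact Finset.sum_congr rfl fun _ _ => mul_comm _ _
  rw [this]
  exact sum_mem fun p hp => (h p hp).basis.mem₁

lemma mem₂ (h : P.DescribesAll L n m) : ((P.A₂ n m : ℤ), (P.B₂ n m : ℤ)) ∈ L := by
  have : ((P.A₂ n m : ℤ), (P.B₂ n m : ℤ)) = ∑ p ∈ primesOf n m,
      (((n / p ^ n.factorization p : ℕ) : ℤ) * P.coeffA₂ p (n.factorization p),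
        ((m / p ^ m.factorization p : ℕ) : ℤ) * P.coeffB₂ p (m.factorization p)) := by
    apply Prod.ext
    · simp only [Prod.fst_sum, Params.A₂]; push_cast; exact Finset.sum_congr rfl fun _ _ => mul_comm _ _
    · simp only [Prod.snd_sum, Params.B₂]; push_cast; exact Finset.sum_congr rfl fun _ _ => mul_comm _ _
  rw [this]
  exact sum_mem fun p hp => (h p hp).basis.mem₂

end Params.DescribesAll

/-- Carries a relation at one prime over to the global generators. One factor `r` comes from the
rescaling of coordinates; the second supplies the cofactor `s` needed to replace the local terms
`us`, `vs` by `u'`, `v'`. -/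
lemma dvd_lift {q r s t n x i j u u' v v' : ℤ} (hn : q * s = n) (hx : q ∣ t * x - (i * u + j * v))
    (hu : n ∣ s * (u' - u * s)) (hv : n ∣ s * (v' - v * s)) (hr : r = s * t) :
    n ∣ r ^ 2 * x - (r * i * u' + r * j * v') := by
  have h1 : n ∣ s * (t * x - (i * u + j * v)) := by
    rw [← hn, mul_comm]; exact mul_dvd_mul_left _ hx
  have : r ^ 2 * x - (r * i * u' + r * j * v') = r * (s * (t * x - (i * u + j * v))) -
      t * (i * (s * (u' - u * s)) + j * (s * (v' - v * s))) := by rw [hr]; ring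
  rw [this]
  exact (h1.mul_left _).sub (((hu.mul_left _).add (hv.mul_left _)).mul_left _)

lemma Params.DescribesAll.span {P : Params} {L : AddSubgroup (ℤ × ℤ)} {n m : ℕ} (hn : n ≠ 0)
    (hm : m ≠ 0) (h : P.DescribesAll L n m) {x y : ℤ} (hxy : (x, y) ∈ L) :
    ∃ i j : ℤ, (n : ℤ) ∣ x - (i * P.A₁ n m + j * P.A₂ n m) ∧
      (m : ℤ) ∣ y - (i * P.B₁ n m + j * P.B₂ n m) := by
  have hS : ∀ q ∈ primesOf n m, q.Prime := fun q hq => prime_of_mem_primesOf hq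
  -- `H` is the ideal of multipliers that bring `(x, y)` into the span. It contains `nm`, and for
  -- each prime `p` dividing `nm` it contains the number `(st)^2` prime to `p`; hence it is all of
  -- `ℤ`.
  let H : AddSubgroup ℤ :=
    { carrier := {t | ∃ i j : ℤ, (n : ℤ) ∣ t * x - (i * P.A₁ n m + j * P.A₂ n m) ∧
        (m : ℤ) ∣ t * y - (i * P.B₁ n m + j * P.B₂ n m)}
      zero_mem' := ⟨0, 0, by simp, by simp⟩
      add_mem' := by
        rintro s t ⟨i, j, h1, h2⟩ ⟨i', j', h3, h4⟩
        refine ⟨i + i', j + j', ?_, ?_⟩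
        · exact (h1.add h3).trans (dvd_of_eq (by ring))
        · exact (h2.add h4).trans (dvd_of_eq (by ring))
      neg_mem' := by
        rintro s ⟨i, j, h1, h2⟩
        refine ⟨-i, -j, ?_, ?_⟩
        · exact h1.neg_right.trans (dvd_of_eq (by ring))
        · exact h2.neg_right.trans (dvd_of_eq (by ring)) }
  suffices h1 : (1 : ℤ) ∈ H by
    obtain ⟨i, j, h2, h3⟩ := h1
    exact ⟨i, j, by simpa using h2, by simpa using h3⟩
  obtain ⟨g, hg⟩ := Int.subgroup_cyclic H
  have hmem : ∀ t, t ∈ H ↔ g ∣ t := fun t => by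
    rw [hg, AddSubgroup.mem_closure_singleton]
    constructor
    · rintro ⟨r, rfl⟩; exact Dvd.intro_left r (by simp)
    · rintro ⟨r, rfl⟩; exact ⟨r, by simp [mul_comm]⟩
  have hnm : ((n * m : ℕ) : ℤ) ∈ H := by
    refine ⟨0, 0, ?_, ?_⟩
    · exact ⟨m * x, by push_cast; ring⟩
    · exact ⟨n * y, by push_cast; ring⟩
  rw [hmem, ← Int.natAbs_dvd_natAbs]
  by_contra hne
  have hg1 : g.natAbs ≠ 1 := fun h1 => hne (by rw [h1]; exact one_dvd _)
  obtain ⟨p, hp, hpg⟩ := Nat.exists_prime_and_dvd hg1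
  have hpnm : p ∣ n * m := hpg.trans (by
    have := Int.natAbs_dvd_natAbs.2 ((hmem _).1 hnm); rwa [Int.natAbs_natCast] at this)
  have hpS : p ∈ primesOf n m := Nat.mem_primeFactors.2 ⟨hp, hpnm, mul_ne_zero hn hm⟩
  set s : ℕ := n / p ^ n.factorization p with hs
  set t : ℕ := m / p ^ m.factorization p with ht
  obtain ⟨i, j, hi, hj⟩ := (h p hpS).basis.span (t * x) (s * y) (by
    rw [mem_scaledComap]
    have := L.zsmul_mem hxy ((s : ℤ) * t)
    have e : ((s : ℤ) * (t * x), (t : ℤ) * (s * y)) = ((s : ℤ) * t) • (x, y) := by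
      ext <;> simp <;> ring
    rw [e]; exact this)
  have hst : (s * t : ℤ) ^ 2 ∈ H := by
    refine ⟨s * t * i, s * t * j, ?_, ?_⟩
    · exact dvd_lift (pow_mul_cofactor n p) hi
        (dvd_cofactor_mul_sum_sub hS hpS (fun q => P.coeffA₁ q (n.factorization q)))
        (dvd_cofactor_mul_sum_sub hS hpS (fun q => P.coeffA₂ q (n.factorization q))) rfl
    · exact dvd_lift (pow_mul_cofactor m p) hj
        (dvd_cofactor_mul_sum_sub hS hpS (fun q => P.coeffB₁ q (m.factorization q)))
        (dvd_cofactor_mul_sum_sub hS hpS (fun q => P.coeffB₂ q (m.factorization q)))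
        (mul_comm _ _)
  have hd : p ∣ (s * t) ^ 2 := by
    have h1 : (p : ℤ) ∣ (s * t : ℤ) ^ 2 := (Int.natCast_dvd.2 hpg).trans ((hmem _).1 hst)
    exact_mod_cast h1
  rcases (hp.dvd_mul).1 (hp.dvd_of_dvd_pow hd) with h1 | h1
  · exact Nat.not_dvd_ordCompl hp hn h1
  · exact Nat.not_dvd_ordCompl hp hm h1

/-! ### From lattices back to subgroups of `C_n × C_m`. -/

lemma R_two_pi_div_eq_one_iff {n : ℕ} (hn : n ≠ 0) (z : ℤ) :
    R (2 * Real.pi / n * z) = 1 ↔ (n : ℤ) ∣ z := by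
  have hn' : (n : ℝ) ≠ 0 := by exact_mod_cast hn
  rw [R_eq_one_iff]
  refine exists_congr fun k => ?_
  constructor
  · intro h
    field_simp at h
    have : (z : ℝ) = n * k := by linarith
    exact_mod_cast this
  · rintro rfl
    push_cast
    field_simp

/-- The homomorphism `(i, j) ↦ (R(2πi/n), R(2πj/m))`. -/
noncomputable def rot (n m : ℕ) : Multiplicative (ℤ × ℤ) →* GG where
  toFun z := (R (2 * Real.pi / n * z.toAdd.1), R (2 * Real.pi / m * z.toAdd.2))
  map_one' := by simp [R_zero]
  map_mul' z w := by
    ext1 <;> simp [mul_add, R_add]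

lemma rot_ofAdd (n m : ℕ) (i j : ℤ) : rot n m (Multiplicative.ofAdd (i, j)) =
    (R (2 * Real.pi / n * i), R (2 * Real.pi / m * j)) := rfl

lemma rot_eq_one_iff {n m : ℕ} (hn : n ≠ 0) (hm : m ≠ 0) (i j : ℤ) :
    rot n m (Multiplicative.ofAdd (i, j)) = 1 ↔ (n : ℤ) ∣ i ∧ (m : ℤ) ∣ j := by
  rw [rot_ofAdd, Prod.mk_eq_one, R_two_pi_div_eq_one_iff hn, R_two_pi_div_eq_one_iff hm]

lemma rot_comb (n m : ℕ) (i j a b a' b' : ℤ) :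
    rot n m (Multiplicative.ofAdd (i * a + j * a', i * b + j * b')) =
      rot n m (Multiplicative.ofAdd (a, b)) ^ i * rot n m (Multiplicative.ofAdd (a', b')) ^ j := by
  have h : Multiplicative.ofAdd (i * a + j * a', i * b + j * b') =
      Multiplicative.ofAdd (a, b) ^ i * Multiplicative.ofAdd (a', b') ^ j := by
    rw [← ofAdd_zsmul, ← ofAdd_zsmul, ← ofAdd_add]
    simp
  rw [h, map_mul, map_zpow, map_zpow]

lemma exists_rot_of_mem {n m : ℕ} {g : GG} (hg : g ∈ (Cyc n).prod (Cyc m)) :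
    ∃ i j : ℤ, g = rot n m (Multiplicative.ofAdd (i, j)) := by
  obtain ⟨i, hi⟩ := Subgroup.mem_zpowers_iff.1 hg.1
  obtain ⟨j, hj⟩ := Subgroup.mem_zpowers_iff.1 hg.2
  refine ⟨i, j, ?_⟩
  have := rot_comb n m i j 1 0 0 1
  simp only [mul_one, mul_zero, add_zero, zero_add] at this
  rw [this, rot_ofAdd, rot_ofAdd]
  ext1
  · simp [R_zero, hi]
  · simp [R_zero, hj]

lemma R_half {n : ℕ} (hn : n ≠ 0) {z : ℤ} (h : 2 * z = n) : R (2 * Real.pi / n * z) = R Real.pi := by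
  have hn' : (n : ℝ) ≠ 0 := by exact_mod_cast hn
  have : (2 : ℝ) * z = n := by exact_mod_cast h
  congr 1
  field_simp
  linarith

/-- The pairs `(i, j)` with `(R(2πi/n), R(2πj/m)) ∈ D`. -/
noncomputable def rotLattice (D : Subgroup GG) (n m : ℕ) : AddSubgroup (ℤ × ℤ) :=
  Subgroup.toAddSubgroup' (D.comap (rot n m))

lemma mem_rotLattice {D : Subgroup GG} {n m : ℕ} {i j : ℤ} :
    (i, j) ∈ rotLattice D n m ↔ rot n m (Multiplicative.ofAdd (i, j)) ∈ D := Iff.rfl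

lemma two_mul_half {n : ℕ} (hn : n ≠ 0) (he : Even n) :
    2 * (((n / 2 ^ n.factorization 2 : ℕ) : ℤ) * 2 ^ (n.factorization 2 - 1)) = n := by
  have h0 : n.factorization 2 ≠ 0 :=
    (Nat.prime_two.factorization_pos_of_dvd hn he.two_dvd).ne'
  obtain ⟨a, ha⟩ := Nat.exists_eq_add_one_of_ne_zero h0
  conv_rhs => rw [← pow_mul_cofactor n 2]
  rw [ha, Nat.add_sub_cancel, pow_succ, Nat.cast_ofNat]
  ring

lemma two_block_of_describesAll {P : Params} {D : Subgroup GG} {n m : ℕ} (hn : n ≠ 0) (hm : m ≠ 0)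
    (hne : Even n) (hme : Even m) (hP : P.DescribesAll (rotLattice D n m) n m)
    (h11 : (R Real.pi, R Real.pi) ∈ D) (h10 : (R Real.pi, (1 : G)) ∉ D)
    (h01 : ((1 : G), R Real.pi) ∉ D) : P.block 2 = .nu ∧ Odd (P.c 2) := by
  have h2 : 2 ∈ primesOf n m :=
    Nat.mem_primeFactors.2 ⟨Nat.prime_two, hne.two_dvd.mul_right _, mul_ne_zero hn hm⟩
  have hn1 : ((n : ℤ), (0 : ℤ)) ∈ rotLattice D n m :=
    mem_rotLattice.2 (by rw [(rot_eq_one_iff hn hm _ _).2 ⟨dvd_rfl, dvd_zero _⟩]; exact D.one_mem)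
  have hm1 : ((0 : ℤ), (m : ℤ)) ∈ rotLattice D n m :=
    mem_rotLattice.2 (by rw [(rot_eq_one_iff hn hm _ _).2 ⟨dvd_zero _, dvd_rfl⟩]; exact D.one_mem)
  have ha := left_mem_scaledComap hn1 (m / 2 ^ m.factorization 2 : ℕ) 2
  have hb := right_mem_scaledComap hm1 (n / 2 ^ n.factorization 2 : ℕ) 2
  refine (hP 2 h2).two_block_eq (Nat.prime_two.factorization_pos_of_dvd hn hne.two_dvd)
    ha hb ?_ ?_ ?_
  · rw [mem_scaledComap, mem_rotLattice, rot_ofAdd, R_half hn (two_mul_half hn hne),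
      R_half hm (two_mul_half hm hme)]
    exact h11
  · rw [mem_scaledComap, mem_rotLattice, rot_ofAdd, R_half hn (two_mul_half hn hne)]
    simpa [R_zero] using h10
  · rw [mem_scaledComap, mem_rotLattice, rot_ofAdd, R_half hm (two_mul_half hm hme)]
    simpa [R_zero] using h01

/-! ### Products of cyclic groups and their non-uniqueness. -/

lemma orderOf_eq_of_zpow_eq_one_iff {Γ : Type*} [Group Γ] {x : Γ} {N : ℕ}
    (h : ∀ i : ℤ, x ^ i = 1 ↔ (N : ℤ) ∣ i) : orderOf x = N := by
  apply Nat.dvd_antisymm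
  · exact Int.natCast_dvd_natCast.1 (orderOf_dvd_iff_zpow_eq_one.2 ((h N).2 dvd_rfl))
  · exact Int.natCast_dvd_natCast.1 ((h _).1 (orderOf_dvd_iff_zpow_eq_one.1 dvd_rfl))

lemma isCyclicProduct_zpowers {C : Subgroup GG} {x y : GG} (hx : x ∈ C) (hy : y ∈ C)
    (hcomm : Commute x y) (hinf : ∀ i j : ℤ, x ^ i = y ^ j → x ^ i = 1)
    (hsup : C ≤ Subgroup.zpowers x ⊔ Subgroup.zpowers y) :
    IsCyclicProduct C (Subgroup.zpowers x) (Subgroup.zpowers y) where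
  cyclic₁ := inferInstance
  cyclic₂ := inferInstance
  commute := by
    rintro _ ⟨i, rfl⟩ _ ⟨j, rfl⟩
    exact hcomm.zpow_zpow i j
  inf_eq := by
    rw [eq_bot_iff]
    rintro _ ⟨⟨i, rfl⟩, ⟨j, hj⟩⟩
    exact Subgroup.mem_bot.2 (hinf i j hj.symm)
  sup_eq := le_antisymm (sup_le (Subgroup.zpowers_le.2 hx) (Subgroup.zpowers_le.2 hy)) hsup

lemma IsCyclicProduct.map {C C₁ C₂ : Subgroup GG} (h : IsCyclicProduct C C₁ C₂) (e : GG ≃* GG) :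
    IsCyclicProduct (C.map e.toMonoidHom) (C₁.map e.toMonoidHom) (C₂.map e.toMonoidHom) where
  cyclic₁ :=
    have := h.cyclic₁
    isCyclic_of_surjective _ (e.subgroupMap C₁).surjective
  cyclic₂ :=
    have := h.cyclic₂
    isCyclic_of_surjective _ (e.subgroupMap C₂).surjective
  commute := by
    rintro _ ⟨x, hx, rfl⟩ _ ⟨y, hy, rfl⟩
    rw [← map_mul, ← map_mul, h.commute x hx y hy]
  inf_eq := by
    rw [← Subgroup.map_inf_eq _ _ _ e.injective, h.inf_eq, Subgroup.map_bot]
  sup_eq := by rw [← Subgroup.map_sup, h.sup_eq]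

/-- Replacing `x` by `xy` gives a second decomposition: if `(xy)^i` lies in `⟨y⟩` then `x^i = 1`,
and the divisibility of orders yields `y^i = 1` too. As unordered pairs the two could agree only if
`y` lay in `⟨x⟩`. -/
lemma nontrivial_isCyclicProduct {C : Subgroup GG} {x y : GG}
    (h : IsCyclicProduct C (Subgroup.zpowers x) (Subgroup.zpowers y))
    (hord : orderOf y ∣ orderOf x) (hy : y ≠ 1) :
    {d : Sym2 (Subgroup GG) |
      ∃ C₁ C₂ : Subgroup GG, d = s(C₁, C₂) ∧ IsCyclicProduct C C₁ C₂}.Nontrivial := by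
  have hcomm : Commute x y :=
    h.commute x (Subgroup.mem_zpowers x) y (Subgroup.mem_zpowers y)
  have hx1 : x ∈ C := h.sup_eq ▸ Subgroup.mem_sup_left (Subgroup.mem_zpowers x)
  have hy1 : y ∈ C := h.sup_eq ▸ Subgroup.mem_sup_right (Subgroup.mem_zpowers y)
  have hbot : ∀ z, z ∈ Subgroup.zpowers x → z ∈ Subgroup.zpowers y → z = 1 := fun z h1 h2 => by
    have : z ∈ Subgroup.zpowers x ⊓ Subgroup.zpowers y := ⟨h1, h2⟩
    rwa [h.inf_eq, Subgroup.mem_bot] at this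
  have h' : IsCyclicProduct C (Subgroup.zpowers (x * y)) (Subgroup.zpowers y) := by
    refine isCyclicProduct_zpowers (mul_mem hx1 hy1) hy1 (hcomm.mul_left (Commute.refl y)) ?_ ?_
    · intro i j hij
      rw [hcomm.mul_zpow] at hij ⊢
      have hxi : x ^ i = 1 := hbot _ ⟨i, rfl⟩ ⟨j - i, by
        change y ^ (j - i) = x ^ i
        rw [zpow_sub, ← hij, mul_inv_cancel_right]⟩
      have hyi : y ^ i = 1 := by
        rw [← orderOf_dvd_iff_zpow_eq_one] at hxi ⊢
        exact (Int.natCast_dvd_natCast.2 hord).trans hxi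
      rw [hxi, hyi, one_mul]
    · rw [← h.sup_eq]
      have hy2 := Subgroup.mem_sup_right (S := Subgroup.zpowers (x * y)) (Subgroup.mem_zpowers y)
      have hxy := Subgroup.mem_sup_left (T := Subgroup.zpowers y) (Subgroup.mem_zpowers (x * y))
      exact sup_le (Subgroup.zpowers_le.2 ((Subgroup.mul_mem_cancel_right _ hy2).1 hxy)) le_sup_right
  refine ⟨_, ⟨_, _, rfl, h⟩, _, ⟨_, _, rfl, h'⟩, ?_⟩
  intro heq
  rcases Sym2.eq_iff.1 heq with ⟨h1, -⟩ | ⟨h1, -⟩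
  · have hxy : x * y ∈ Subgroup.zpowers x := h1 ▸ Subgroup.mem_zpowers (x * y)
    exact hy (hbot y ((Subgroup.mul_mem_cancel_left _ (Subgroup.mem_zpowers x)).1 hxy)
      (Subgroup.mem_zpowers y))
  · exact hy (hbot y (h1 ▸ Subgroup.mem_zpowers y) (Subgroup.mem_zpowers y))

lemma bijOn_pow_zpowers {Γ : Type*} [Group Γ] {x : Γ} {N : ℕ} (hN : 0 < N) (h : orderOf x = N) :
    Set.BijOn (fun i : ℕ => x ^ i) {i | i < N} (Subgroup.zpowers x : Set Γ) := by
  classical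
  subst h
  refine ⟨fun i _ => ⟨i, by simp⟩, pow_injOn_Iio_orderOf, ?_⟩
  intro z hz
  have hz' : z ∈ Subgroup.zpowers x := hz
  rw [(orderOf_pos_iff.1 hN).mem_zpowers_iff_mem_range_orderOf, Finset.mem_image] at hz'
  obtain ⟨i, hi, rfl⟩ := hz'
  exact ⟨i, Finset.mem_range.1 hi, rfl⟩

/-! ### The two explicit generators. -/

lemma exists_generators {D : Subgroup GG} {n m : ℕ} (hn : n ≠ 0) (hm : m ≠ 0)
    (hne : Even n) (hme : Even m) (hD : D ≤ (Cyc n).prod (Cyc m))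
    (hcyc : ¬ ∃ a : GG, D = Subgroup.zpowers a)
    (h11 : (R Real.pi, R Real.pi) ∈ D) (h10 : (R Real.pi, (1 : G)) ∉ D)
    (h01 : ((1 : G), R Real.pi) ∉ D) :
    ∃ (P : Params) (x y : GG), P.Admissible n m ∧
      IsCyclicProduct D (Subgroup.zpowers x) (Subgroup.zpowers y) ∧
      0 < P.order₁ n m ∧ 0 < P.order₂ n m ∧
      orderOf x = P.order₁ n m ∧ orderOf y = P.order₂ n m ∧ P.order₂ n m ∣ P.order₁ n m ∧
      (P.elt₁ n m = fun i => x ^ i) ∧ (P.elt₂ n m = fun i => y ^ i) ∧ y ≠ 1 := by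
  have hn1 : ((n : ℤ), (0 : ℤ)) ∈ rotLattice D n m :=
    mem_rotLattice.2 (by rw [(rot_eq_one_iff hn hm _ _).2 ⟨dvd_rfl, dvd_zero _⟩]; exact D.one_mem)
  have hm1 : ((0 : ℤ), (m : ℤ)) ∈ rotLattice D n m :=
    mem_rotLattice.2 (by rw [(rot_eq_one_iff hn hm _ _).2 ⟨dvd_zero _, dvd_rfl⟩]; exact D.one_mem)
  obtain ⟨P, hP⟩ := exists_describesAll hn1 hm1
  set x := rot n m (Multiplicative.ofAdd ((P.A₁ n m : ℤ), (P.B₁ n m : ℤ))) with hx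
  set y := rot n m (Multiplicative.ofAdd ((P.A₂ n m : ℤ), (P.B₂ n m : ℤ))) with hy
  have hrel : ∀ i j : ℤ, x ^ i * y ^ j = 1 ↔ (P.order₁ n m : ℤ) ∣ i ∧ (P.order₂ n m : ℤ) ∣ j := by
    intro i j
    rw [hx, hy, ← rot_comb, rot_eq_one_iff hn hm, hP.dvd_iff hn hm]
  have hox : orderOf x = P.order₁ n m := orderOf_eq_of_zpow_eq_one_iff fun i => by
    have := hrel i 0
    simpa using this
  have hoy : orderOf y = P.order₂ n m := orderOf_eq_of_zpow_eq_one_iff fun j => by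
    have := hrel 0 j
    simpa using this
  have hsup : ∀ z ∈ D, ∃ i j : ℤ, z = x ^ i * y ^ j := by
    intro z hz
    obtain ⟨s, t, rfl⟩ := exists_rot_of_mem (hD hz)
    obtain ⟨i, j, h1, h2⟩ := hP.span hn hm (mem_rotLattice.2 hz)
    refine ⟨i, j, ?_⟩
    rw [hx, hy, ← rot_comb, ← div_eq_one, ← map_div]
    exact (rot_eq_one_iff hn hm _ _).2 ⟨h1, h2⟩
  have hy1 : y ≠ 1 := by
    intro h1
    refine hcyc ⟨x, le_antisymm (fun z hz => ?_) (Subgroup.zpowers_le.2 hP.mem₁)⟩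
    obtain ⟨i, j, rfl⟩ := hsup z hz
    rw [h1, one_zpow, mul_one]
    exact ⟨i, rfl⟩
  have htwo := two_block_of_describesAll hn hm hne hme hP h11 h10 h01
  refine ⟨P, x, y, ⟨fun p hp => (hP p hp).inRange, htwo.1, htwo.2, ?_⟩, ?_, hP.order₁_pos,
    hP.order₂_pos, hox, hoy, hP.order₂_dvd_order₁, ?_, ?_, hy1⟩
  -- If no prime occurred twice, every `l` would vanish and `y` would have order one.
  · by_contra hno
    push Not at hno
    apply hy1
    rw [← orderOf_eq_one_iff, hoy, hP.order₂_eq]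
    exact Finset.prod_eq_one fun p hp => by rw [(hP p hp).l_eq_zero (hno p hp), pow_zero]
  · refine isCyclicProduct_zpowers hP.mem₁ hP.mem₂ ?_ ?_ fun z hz => ?_
    · change x * y = y * x
      exact ((Commute.all _ _).map (rot n m)).eq
    · intro i j hij
      have h1 : x ^ i * y ^ (-j) = 1 := by rw [hij, zpow_neg, mul_inv_cancel]
      have h2 := (hrel i 0).2 ⟨((hrel i (-j)).1 h1).1, dvd_zero _⟩
      simpa using h2
    · obtain ⟨i, j, rfl⟩ := hsup z hz
      exact mul_mem (Subgroup.mem_sup_left ⟨i, rfl⟩) (Subgroup.mem_sup_right ⟨j, rfl⟩)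
  · funext i
    rw [hx, ← map_pow]
    ext1
    · simp [Params.elt₁, rot, mul_comm, mul_left_comm]
    · simp [Params.elt₁, rot, mul_comm, mul_left_comm]
  · funext i
    rw [hy, ← map_pow]
    ext1
    · simp [Params.elt₂, rot, mul_comm, mul_left_comm]
    · simp [Params.elt₂, rot, mul_comm, mul_left_comm]

lemma mem_map_conj_iff_of_commute {C : Subgroup GG} {g z : GG} (h : Commute g z) :
    z ∈ C.map (MulAut.conj g).toMonoidHom ↔ z ∈ C := by
  have hz : MulAut.conj g z = z := by rw [MulAut.conj_apply, h.eq, mul_inv_cancel_right]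
  constructor
  · rintro ⟨w, hw, hwz⟩
    have : w = z := (MulAut.conj g).injective (hwz.trans hz.symm)
    rwa [← this]
  · intro hC
    exact ⟨z, hC, hz⟩

lemma map_conj_inv_map_conj (C : Subgroup GG) (g : GG) :
    (C.map (MulAut.conj g).toMonoidHom).map (MulAut.conj g⁻¹).toMonoidHom = C := by
  rw [Subgroup.map_map]
  convert Subgroup.map_id C
  ext1 z
  simp [mul_assoc]

end HB

theorem mainTheorem11 (C : Subgroup HB.GG) (hC : HB.IsLittleGroup C)
    (hfin : (C : Set HB.GG).Finite) (h2 : HB.HasTwoGenerators C) :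
    -- `C` is a direct product of two cyclic groups, and not in a unique way
    {d : Sym2 (Subgroup HB.GG) |
      ∃ C₁ C₂ : Subgroup HB.GG, d = s(C₁, C₂) ∧ HB.IsCyclicProduct C C₁ C₂}.Nontrivial ∧
    -- up to conjugation, `C` is a subgroup of `SO(2) × SO(2)`
    (∃ g : HB.GG, C.map (MulAut.conj g).toMonoidHom ≤ HB.K) ∧
    -- the explicit choice of the two factors, for `C` and for each of its conjugates `D`
    -- which lies in `SO(2) × SO(2)`
    ∀ (g : HB.GG) (D : Subgroup HB.GG), D = C.map (MulAut.conj g).toMonoidHom → D ≤ HB.K →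
      (∃ n m : ℕ, 0 < n ∧ 0 < m ∧ Even n ∧ Even m ∧ D ≤ (HB.Cyc n).prod (HB.Cyc m)) ∧
      ∀ n m : ℕ, 0 < n → 0 < m → Even n → Even m → D ≤ (HB.Cyc n).prod (HB.Cyc m) →
        ∃ P : HB.Params, P.Admissible n m ∧
          ∃ C₁ C₂ : Subgroup HB.GG, HB.IsCyclicProduct D C₁ C₂ ∧
            Set.BijOn (P.elt₁ n m) {i | i < P.order₁ n m} C₁ ∧
            Set.BijOn (P.elt₂ n m) {i | i < P.order₂ n m} C₂ ∧
            Nat.card C₁ = P.order₁ n m ∧ Nat.card C₂ = P.order₂ n m := by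
  obtain ⟨φ, rfl⟩ := hC
  have hfinD : ∀ g : HB.GG,
      (((HB.littleGroup φ).map (MulAut.conj g).toMonoidHom : Subgroup HB.GG) : Set HB.GG).Finite :=
    fun g => hfin.image _
  have hcyc : ∀ g : HB.GG, ¬ ∃ a : HB.GG,
      (HB.littleGroup φ).map (MulAut.conj g).toMonoidHom = Subgroup.zpowers a := by
    rintro g ⟨a, ha⟩
    refine h2.2 ⟨MulAut.conj g⁻¹ a, ?_⟩
    rw [← HB.map_conj_inv_map_conj (HB.littleGroup φ) g, ha, MonoidHom.map_zpowers]
    rfl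
  have hpi : ∀ g : HB.G, Commute g (HB.R Real.pi) := fun g => (HB.R_pi_comm g).symm
  have h11 : ∀ g : HB.GG, (HB.R Real.pi, HB.R Real.pi) ∈
      (HB.littleGroup φ).map (MulAut.conj g).toMonoidHom := fun g =>
    (HB.mem_map_conj_iff_of_commute (Commute.prod (hpi _) (hpi _))).2
      (HB.R_pi_R_pi_mem_littleGroup φ)
  have h10 : ∀ g : HB.GG, (HB.R Real.pi, (1 : HB.G)) ∉
      (HB.littleGroup φ).map (MulAut.conj g).toMonoidHom := fun g h =>
    HB.R_pi_one_not_mem hfin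
      ((HB.mem_map_conj_iff_of_commute (Commute.prod (hpi _) (Commute.one_right _))).1 h)
  have h01 : ∀ g : HB.GG, ((1 : HB.G), HB.R Real.pi) ∉
      (HB.littleGroup φ).map (MulAut.conj g).toMonoidHom := fun g h =>
    HB.one_R_pi_not_mem hfin
      ((HB.mem_map_conj_iff_of_commute (Commute.prod (Commute.one_right _) (hpi _))).1 h)
  obtain ⟨g₀, hg₀⟩ := HB.exists_conj_le_K hfin
  refine ⟨?_, ⟨g₀, hg₀⟩, ?_⟩
  · obtain ⟨n, m, hn, hm, hne, hme, hle⟩ := HB.exists_le_Cyc_prod (hfinD g₀) hg₀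
    obtain ⟨P, x, y, -, hprod, -, -, hx, hy, hdvd, -, -, hy1⟩ :=
      HB.exists_generators hn.ne' hm.ne' hne hme hle (hcyc g₀) (h11 g₀) (h10 g₀) (h01 g₀)
    -- The decomposition is found for a conjugate inside `K` and carried back to the little group
    -- itself.
    have h := hprod.map (MulAut.conj g₀⁻¹)
    rw [HB.map_conj_inv_map_conj, MonoidHom.map_zpowers, MonoidHom.map_zpowers] at h
    refine HB.nontrivial_isCyclicProduct h ?_ ?_
    · have e : ∀ z, orderOf ((MulAut.conj g₀⁻¹).toMonoidHom z) = orderOf z :=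
        fun z => (MulAut.conj g₀⁻¹).orderOf_eq z
      rw [e, e, hx, hy]
      exact hdvd
    · intro h1
      exact hy1 ((MulAut.conj g₀⁻¹).map_eq_one_iff.1 h1)
  · rintro g D rfl hK
    refine ⟨HB.exists_le_Cyc_prod (hfinD g) hK, fun n m hn hm hne hme hle => ?_⟩
    obtain ⟨P, x, y, hadm, hprod, hp1, hp2, hx, hy, -, e1, e2, -⟩ :=
      HB.exists_generators hn.ne' hm.ne' hne hme hle (hcyc g) (h11 g) (h10 g) (h01 g)
    refine ⟨P, hadm, _, _, hprod, ?_, ?_, ?_, ?_⟩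
    · rw [e1]; exact HB.bijOn_pow_zpowers hp1 hx
    · rw [e2]; exact HB.bijOn_pow_zpowers hp2 hy
    · rw [Nat.card_zpowers, hx]
    · rw [Nat.card_zpowers, hy]
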